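/- Let $n\ge 1$, $\gamma>1$, and consider the compressible Euler system for $\rho\ge 0$, $\mathbf V$, $p$, $S$ on $\mathbb R^n$: $$\partial_t(\rho \mathbf V)+\operatorname{div}(\rho \mathbf V\otimes \mathbf V)+\nabla p=0,\quad \partial_t\rho+\operatorname{div}(\rho \mathbf V)=0,\quad \partial_tS+\mathbf V\cdot\nabla S=0,\quad p=e^S\rho^\gamma .$$ Let $\bar\rho,\bar p,\mathcal R_0>0$ be constants and let $(\mathbf V_0,\rho_0,p_0)\in C^1(\mathbb R^n)$ be initial data with $\rho_0,p_0>0$ and $(\mathbf V_0,\rho_0,p_0)(x)=(\mathbf 0,\bar\rho,\bar p)$ for $|x|\ge\mathcal R_0$. Put $\sigma=\sqrt{\gamma\bar p/\bar\rho}$, $S_0=\ln(p_0/\rho_0^\gamma)$, let $\omega_n$ be the volume of the unit ball, and $$m(0)=\int_{|x|<\mathcal R_0}(\rho_0-\bar\rho)\,dx,\qquad e(0)=\frac12\int_{\mathbb R^n}\rho_0|\mathbf V_0|^2dx+\frac1{\gamma-1}\int_{|x|<\mathcal R_0}(p_0-\bar p)\,dx .$$ Let $0<R\le\mathcal R_0$,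 $k>n$, $\mathcal B_R=\{|x|\le R\}$, $B=\frac{k}{R^2(k-1)}$, $C=B(k-1)$, and let $\phi(r)=1-Br^2$ for $0\le r<R-\frac Rk$, $\phi(r)=C(r-R)^2$ for $R-\frac Rk\le r\le R$, $\phi(r)=0$ for $r>R$. Set $$K=\int_{\mathbb R^n}\phi(|x|)\,dx,\quad G_\phi(0)=\int_{\mathbb R^n}\rho_0\,\phi(|x|)\,dx,\quad G_\phi'(0)=\int_{\mathbb R^n}\frac{\phi'(|x|)}{|x|}(\mathbf V_0\cdot x)\,\rho_0\,dx,$$ $$A_1=(k-n)\,\exp\Big\{\inf_{|x|\le\mathcal R_0}S_0\Big\}\Big(\int_{\mathcal B_R}\phi^{\frac{\gamma}{\gamma-1}}dx\Big)^{1-\gamma},\qquad A_2=\max\{2,(\gamma-1)k\}.$$ Let $Q_+(t)=m(0)-\bar\rho K+\bar\rho\,\omega_n(\mathcal R_0+\sigma t)^n$ and let $Q_-$ be the solution on $[0,\infty)$ of $$z''=\varkappa^2z+P_n(t),\qquad z(0)=G_\phi(0)-\bar\rho K,\quad z'(0)=G_\phi'(0),$$ where $\varkappa^2=2\gamma BA_1(\bar\rho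 K)^{\gamma-1}$ and $$P_n(t)=2B\Big(A_1(\bar\rho K)^\gamma-A_2\Big(e(0)+\frac{\bar p}{\gamma-1}\,\omega_n(\mathcal R_0+\sigma t)^n\Big)\Big).$$ If $(\rho,\mathbf V,p,S)$ is a $C^1$ solution on $[0,T)\times\mathbb R^n$ with these initial data, then for all $t\in[0,T)$ $$\sup_{x\in\mathcal B_R}\rho(t,x)\ge\bar\rho+\frac{Q_-(t)}K,\qquad \inf_{x\in\mathcal B_R}\rho(t,x)\le\bar\rho+\frac{Q_+(t)}K .$$ If one of these two inequalities fails at some $t_*>0$ for a solution whose density is continuous on $[0,t_*]\times\mathcal B_R$, then it is not a $C^1$ solution on $[0,t_*)\times\mathbb R^n$, that is, smoothness is lost before $t_*$. -/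

import Mathlib

open Set MeasureTheory Metric

namespace EulerBounds

/-- Euclidean space `ℝⁿ`. -/
abbrev Sp (n : ℕ) := EuclideanSpace ℝ (Fin n)

/-- The partial derivative `∂f/∂x_j` at `x`. -/
noncomputable def pd {n : ℕ} (j : Fin n) (f : Sp n → ℝ) (x : Sp n) : ℝ :=
  fderiv ℝ f x (EuclideanSpace.single j 1)

/-- `(ρ, V, p, S)` is a classical (`C¹`) solution of the compressible Euler system with heat
ratio `γ` on the time interval `[0, T)`, in the whole space. The first argument of each function
is the time. The density is nonnegative. The equations are required at the interior times; they
extend to `t = 0` by the `C¹` regularity up to `t = 0`. -/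
structure IsClassicalSolution {n : ℕ} (γ T : ℝ) (ρ : ℝ → Sp n → ℝ) (V : ℝ → Sp n → Sp n)
    (p S : ℝ → Sp n → ℝ) : Prop where
  smooth_density : ContDiffOn ℝ 1 (fun q : ℝ × Sp n => ρ q.1 q.2) (Ico 0 T ×ˢ univ)
  smooth_velocity : ContDiffOn ℝ 1 (fun q : ℝ × Sp n => V q.1 q.2) (Ico 0 T ×ˢ univ)
  smooth_pressure : ContDiffOn ℝ 1 (fun q : ℝ × Sp n => p q.1 q.2) (Ico 0 T ×ˢ univ)
  smooth_entropy : ContDiffOn ℝ 1 (fun q : ℝ × Sp n => S q.1 q.2) (Ico 0 T ×ˢ univ)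
  density_nonneg : ∀ t ∈ Ico 0 T, ∀ x, 0 ≤ ρ t x
  momentum : ∀ t ∈ Ioo 0 T, ∀ x, ∀ i : Fin n,
    deriv (fun s => ρ s x * V s x i) t
      + ∑ j, pd j (fun y => ρ t y * V t y i * V t y j) x + pd i (p t) x = 0
  mass : ∀ t ∈ Ioo 0 T, ∀ x,
    deriv (fun s => ρ s x) t + ∑ j, pd j (fun y => ρ t y * V t y j) x = 0
  entropy : ∀ t ∈ Ioo 0 T, ∀ x,
    deriv (fun s => S s x) t + ∑ j, V t x j * pd j (S t) x = 0
  state : ∀ t ∈ Ico 0 T, ∀ x, p t x = Real.exp (S t x) * ρ t x ^ γ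

/-- `C¹` initial data with positive density and pressure that coincide with the constant state
`(0, rbar, pbar)` outside the open ball of radius `R0` about the origin. -/
structure IsPerturbationData {n : ℕ} (rbar pbar R0 : ℝ) (ρ0 : Sp n → ℝ) (V0 : Sp n → Sp n)
    (p0 : Sp n → ℝ) : Prop where
  smooth_density : ContDiff ℝ 1 ρ0
  smooth_velocity : ContDiff ℝ 1 V0
  smooth_pressure : ContDiff ℝ 1 p0
  density_pos : ∀ x, 0 < ρ0 x
  pressure_pos : ∀ x, 0 < p0 x
  density_far : ∀ x, x ∉ ball (0 : Sp n) R0 → ρ0 x = rbar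
  velocity_far : ∀ x, x ∉ ball (0 : Sp n) R0 → V0 x = 0
  pressure_far : ∀ x, x ∉ ball (0 : Sp n) R0 → p0 x = pbar

/-- The volume `ω_n` of the unit ball of `ℝⁿ`. -/
noncomputable def unitBallVolume (n : ℕ) : ℝ := volume.real (ball (0 : Sp n) 1)

/-- The sound speed `σ = √(∂p/∂ρ)` of the state `(rbar, pbar)`. -/
noncomputable def soundSpeed (γ rbar pbar : ℝ) : ℝ := Real.sqrt (γ * pbar / rbar)

/-- The radius `R0 + σ t` of the ball containing the perturbation at time `t`. -/
noncomputable def frontRadius (γ rbar pbar R0 t : ℝ) : ℝ := R0 + soundSpeed γ rbar pbar * t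

/-- `B = k / (R² (k - 1))`. -/
noncomputable def Bc (R k : ℝ) : ℝ := k / (R ^ 2 * (k - 1))

/-- `C = B (k - 1)`. -/
noncomputable def Cc (R k : ℝ) : ℝ := Bc R k * (k - 1)

/-- The radial profile `φ`. -/
noncomputable def phi (R k r : ℝ) : ℝ :=
  if r < R - R / k then 1 - Bc R k * r ^ 2
  else if r ≤ R then Cc R k * (r - R) ^ 2
  else 0

/-- `K = ∫ φ(|x|) dx`. -/
noncomputable def Kc (n : ℕ) (R k : ℝ) : ℝ := ∫ x : Sp n, phi R k ‖x‖

/-- `G_φ = ∫ ρ φ(|x|) dx` for a density `ρ0`. -/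
noncomputable def Gphi {n : ℕ} (R k : ℝ) (ρ0 : Sp n → ℝ) : ℝ := ∫ x, ρ0 x * phi R k ‖x‖

/-- `G'_φ = ∫ (φ'(|x|) / |x|) (V · x) ρ dx` for a density `ρ0` and a velocity `V0`. -/
noncomputable def Gphi' {n : ℕ} (R k : ℝ) (ρ0 : Sp n → ℝ) (V0 : Sp n → Sp n) : ℝ :=
  ∫ x, deriv (phi R k) ‖x‖ / ‖x‖ * inner ℝ (V0 x) x * ρ0 x

/-- The initial entropy, from `p = e^S ρ^γ`. -/
noncomputable def initialEntropy {n : ℕ} (γ : ℝ) (ρ0 p0 : Sp n → ℝ) (x : Sp n) : ℝ :=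
  Real.log (p0 x / ρ0 x ^ γ)

/-- `A₁ = (k - n) exp(inf S₀) (∫_{B_R} φ^{γ/(γ-1)} dx)^{1-γ}`, the infimum being taken over the
ball of radius `R0` that contains the initial perturbation. -/
noncomputable def A1 {n : ℕ} (γ R0 R k : ℝ) (ρ0 p0 : Sp n → ℝ) : ℝ :=
  (k - n) * Real.exp (sInf (initialEntropy γ ρ0 p0 '' closedBall 0 R0))
    * (∫ x in closedBall (0 : Sp n) R, phi R k ‖x‖ ^ (γ / (γ - 1))) ^ (1 - γ)

/-- `A₂ = max {2, (γ - 1) k}`. -/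
noncomputable def A2 (γ k : ℝ) : ℝ := max 2 ((γ - 1) * k)

/-- The initial excess mass `m(0)`. -/
noncomputable def excessMass {n : ℕ} (rbar R0 : ℝ) (ρ0 : Sp n → ℝ) : ℝ :=
  ∫ x in ball (0 : Sp n) R0, (ρ0 x - rbar)

/-- The initial excess energy `e(0)`. -/
noncomputable def excessEnergy {n : ℕ} (γ pbar R0 : ℝ) (ρ0 : Sp n → ℝ) (V0 : Sp n → Sp n)
    (p0 : Sp n → ℝ) : ℝ :=
  1 / 2 * (∫ x, ρ0 x * ‖V0 x‖ ^ 2) + 1 / (γ - 1) * ∫ x in ball (0 : Sp n) R0, (p0 x - pbar)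

/-- `Q₊(t) = m(0) - rbar K + rbar ω_n (R0 + σ t)^n`. -/
noncomputable def Qplus {n : ℕ} (γ rbar pbar R0 R k : ℝ) (ρ0 : Sp n → ℝ) (t : ℝ) : ℝ :=
  excessMass rbar R0 ρ0 - rbar * Kc n R k
    + rbar * unitBallVolume n * frontRadius γ rbar pbar R0 t ^ n

/-- `ϰ² = 2 γ B A₁ (rbar K)^{γ-1}`. -/
noncomputable def kappaSq {n : ℕ} (γ rbar R0 R k : ℝ) (ρ0 p0 : Sp n → ℝ) : ℝ :=
  2 * γ * Bc R k * A1 γ R0 R k ρ0 p0 * (rbar * Kc n R k) ^ (γ - 1)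

/-- `P_n(t) = 2 B (A₁ (rbar K)^γ - A₂ (e(0) + (pbar / (γ - 1)) ω_n (R0 + σ t)^n))`. -/
noncomputable def Pn {n : ℕ} (γ rbar pbar R0 R k : ℝ) (ρ0 : Sp n → ℝ) (V0 : Sp n → Sp n)
    (p0 : Sp n → ℝ) (t : ℝ) : ℝ :=
  2 * Bc R k * (A1 γ R0 R k ρ0 p0 * (rbar * Kc n R k) ^ γ
    - A2 γ k * (excessEnergy γ pbar R0 ρ0 V0 p0
        + pbar / (γ - 1) * unitBallVolume n * frontRadius γ rbar pbar R0 t ^ n))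

/-- `z` solves on `[0, ∞)` the initial value problem
`z'' = ϰ² z + P_n(t)`, `z(0) = G_φ(0) - rbar K`, `z'(0) = G'_φ(0)`. -/
def IsQminus {n : ℕ} (γ rbar pbar R0 R k : ℝ) (ρ0 : Sp n → ℝ) (V0 : Sp n → Sp n)
    (p0 : Sp n → ℝ) (z : ℝ → ℝ) : Prop :=
  ∃ z' : ℝ → ℝ,
    (∀ t ∈ Ici (0 : ℝ), HasDerivWithinAt z (z' t) (Ici 0) t) ∧
    (∀ t ∈ Ici (0 : ℝ), HasDerivWithinAt z'
      (kappaSq γ rbar R0 R k ρ0 p0 * z t + Pn γ rbar pbar R0 R k ρ0 V0 p0 t) (Ici 0) t) ∧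
    z 0 = Gphi R k ρ0 - rbar * Kc n R k ∧
    z' 0 = Gphi' R k ρ0 V0

end EulerBounds

namespace EulerBounds

open Filter Topology

/-- The divergence of a vector field. -/
noncomputable def dv {n : ℕ} (F : Sp n → Sp n) (x : Sp n) : ℝ :=
  ∑ j, (fderiv ℝ F x (EuclideanSpace.single j 1)) j

theorem sum_smul_single {n : ℕ} (v : Sp n) : ∑ j, v j • EuclideanSpace.single j (1 : ℝ) = v := by
  ext i
  simp [Finset.sum_apply, Pi.single_apply]

theorem sum_mul_apply_single {n : ℕ} (L : Sp n →L[ℝ] ℝ) (v : Sp n) :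
    ∑ j, v j * L (EuclideanSpace.single j 1) = L v := by
  conv_rhs => rw [← sum_smul_single v]
  simp [map_sum]

theorem fderiv_apply_coord {n : ℕ} {F : Sp n → Sp n} {x : Sp n} (hF : DifferentiableAt ℝ F x)
    (v : Sp n) (j : Fin n) : fderiv ℝ (fun y => F y j) x v = (fderiv ℝ F x v) j := by
  have := ((EuclideanSpace.proj (𝕜 := ℝ) j).hasFDerivAt.comp x hF.hasFDerivAt).fderiv
  exact congrArg (fun L => L v) this

theorem contDiff_coord {n : ℕ} {F : Sp n → Sp n} (hF : ContDiff ℝ 1 F) (j : Fin n) :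
    ContDiff ℝ 1 (fun y => F y j) :=
  (EuclideanSpace.proj (𝕜 := ℝ) j).contDiff.comp hF

theorem exists_cutoff {n : ℕ} (K : Set (Sp n)) (hK : IsCompact K) :
    ∃ χ : Sp n → ℝ, ContDiff ℝ 1 χ ∧ HasCompactSupport χ ∧ ∀ x ∈ K, χ =ᶠ[𝓝 x] 1 := by
  obtain ⟨L, hL⟩ := hK.isBounded.subset_ball (0 : Sp n)
  let b : ContDiffBump (0 : Sp n) :=
    ⟨max L 1, max L 1 + 1, by positivity, by linarith⟩
  refine ⟨b, b.contDiff, b.hasCompactSupport, fun x hx => b.eventuallyEq_one_of_mem_ball ?_⟩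
  exact ball_subset_ball (le_max_left _ _) (hL hx)

section ibp

variable {n : ℕ} {w : Sp n → ℝ} {C : NNReal} {w' : Sp n → Sp n →L[ℝ] ℝ}

theorem integral_fderiv_mul_eq_neg {f : Sp n → ℝ} (hf : ContDiff ℝ 1 f)
    (hw : LipschitzWith C w) (hc : HasCompactSupport w)
    (hw' : ∀ᵐ x, HasFDerivAt w (w' x) x) (v : Sp n) :
    Integrable (fun x => f x * w' x v) ∧
      ∫ x, fderiv ℝ f x v * w x = -∫ x, f x * w' x v := by
  obtain ⟨χ, hχ, hχc, hχ1⟩ := exists_cutoff (tsupport w) hc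
  have hg : ContDiff ℝ 1 (fun x => f x * χ x) := hf.mul hχ
  have hgc : HasCompactSupport (fun x => f x * χ x) := hχc.mul_left
  obtain ⟨D, hD⟩ := hg.lipschitzWith_of_hasCompactSupport hgc one_ne_zero
  have key := hD.integral_lineDeriv_mul_eq (μ := volume) hw hc v
  have e1 : ∀ x, lineDeriv ℝ (fun x => f x * χ x) x v * w x = fderiv ℝ f x v * w x := by
    intro x
    by_cases hx : x ∈ tsupport w
    · have : (fun x => f x * χ x) =ᶠ[𝓝 x] f := by
        filter_upwards [hχ1 x hx] with y hy
        simp [hy]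
      rw [this.lineDeriv_eq, ((hf.differentiable one_ne_zero) x).lineDeriv_eq_fderiv]
    · rw [image_eq_zero_of_notMem_tsupport hx]; simp
  have e2 : ∀ᵐ x, lineDeriv ℝ w x (-v) * (f x * χ x) = -(f x * w' x v) := by
    filter_upwards [hw'] with x hx
    rw [hx.differentiableAt.lineDeriv_eq_fderiv, hx.fderiv]
    by_cases hxt : x ∈ tsupport w
    · rw [show χ x = 1 from (hχ1 x hxt).eq_of_nhds]; simp [mul_comm]
    · have h0 : w' x = 0 := by
        have : w =ᶠ[𝓝 x] 0 := notMem_tsupport_iff_eventuallyEq.1 hxt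
        rw [← hx.fderiv, this.fderiv_eq]; simp
      simp [h0]
  constructor
  · have hi : Integrable (fun x => -(lineDeriv ℝ w x (-v) * (f x * χ x))) := by
      refine Integrable.neg (Integrable.bdd_mul (c := C * ‖-v‖)
        (hg.continuous.integrable_of_hasCompactSupport hgc)
        (measurable_lineDeriv hw.continuous).aestronglyMeasurable ?_)
      filter_upwards with x using norm_lineDeriv_le_of_lipschitz ℝ hw
    refine hi.congr ?_
    filter_upwards [e2] with x hx
    rw [hx]; ring
  · rw [← integral_neg, ← integral_congr_ae e2, ← key]
    exact integral_congr_ae (Eventually.of_forall fun x => (e1 x).symm)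

theorem integral_div_mul_eq_neg {F : Sp n → Sp n} (hF : ContDiff ℝ 1 F)
    (hw : LipschitzWith C w) (hc : HasCompactSupport w)
    (hw' : ∀ᵐ x, HasFDerivAt w (w' x) x) :
    Integrable (fun x => w' x (F x)) ∧ ∫ x, dv F x * w x = -∫ x, w' x (F x) := by
  have hj := fun j => integral_fderiv_mul_eq_neg (contDiff_coord hF j) hw hc hw'
    (EuclideanSpace.single j 1)
  have e : (fun x => w' x (F x)) = fun x => ∑ j, F x j * w' x (EuclideanSpace.single j 1) := by
    ext x; rw [sum_mul_apply_single]
  have hFd := hF.differentiable one_ne_zero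
  constructor
  · rw [e]; exact integrable_finsetSum _ fun j _ => (hj j).1
  · rw [e, integral_finsetSum _ fun j _ => (hj j).1, ← Finset.sum_neg_distrib]
    simp_rw [← (hj _).2]
    rw [← integral_finsetSum]
    · refine integral_congr_ae (Eventually.of_forall fun x => ?_)
      simp only [dv, Finset.sum_mul]
      refine Finset.sum_congr rfl fun j _ => ?_
      rw [fderiv_apply_coord (hFd x)]
    · intro j _
      refine Continuous.integrable_of_hasCompactSupport ?_ hc.mul_left
      exact (((contDiff_coord hF j).continuous_fderiv one_ne_zero).clm_apply
        continuous_const).mul hw.continuous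

end ibp

section parametric

variable {n : ℕ}

theorem hasDerivAt_integral_of_compact {a b : ℝ} {f f' : ℝ → Sp n → ℝ} {K : Set (Sp n)}
    (hK : IsCompact K)
    (hf : ContinuousOn (fun q : ℝ × Sp n => f q.1 q.2) (Ioo a b ×ˢ univ))
    (hf' : ContinuousOn (fun q : ℝ × Sp n => f' q.1 q.2) (Ioo a b ×ˢ univ))
    (hd : ∀ t ∈ Ioo a b, ∀ x, HasDerivAt (fun s => f s x) (f' t x) t)
    (h0 : ∀ t ∈ Ioo a b, ∀ x ∉ K, f t x = 0) {t : ℝ} (ht : t ∈ Ioo a b) :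
    HasDerivAt (fun s => ∫ x, f s x) (∫ x, f' t x) t := by
  have h0' : ∀ s ∈ Ioo a b, ∀ x ∉ K, f' s x = 0 := by
    intro s hs x hx
    have : (fun s => f s x) =ᶠ[𝓝 s] fun _ => 0 := by
      filter_upwards [isOpen_Ioo.mem_nhds hs] with u hu using h0 u hu x hx
    exact (hd s hs x).unique ((hasDerivAt_const s (0 : ℝ)).congr_of_eventuallyEq this)
  have slice : ∀ {g : ℝ → Sp n → ℝ}, ContinuousOn (fun q : ℝ × Sp n => g q.1 q.2)
      (Ioo a b ×ˢ univ) → ∀ s ∈ Ioo a b, Continuous (g s) := by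
    intro g hg s hs
    rw [← continuousOn_univ]
    exact hg.comp (f := fun x : Sp n => (s, x)) (by fun_prop) fun x _ => ⟨hs, mem_univ _⟩
  obtain ⟨δ, hδ, hball⟩ := Metric.nhds_basis_closedBall.mem_iff.1 (isOpen_Ioo.mem_nhds ht)
  obtain ⟨M, hM⟩ := ((isCompact_closedBall t δ).prod hK).exists_bound_of_continuousOn
    (hf'.mono (prod_mono hball (subset_univ K)))
  refine (hasDerivAt_integral_of_dominated_loc_of_deriv_le (μ := volume)
    (bound := K.indicator fun _ => M) (closedBall_mem_nhds t hδ) ?_ ?_ ?_ ?_ ?_ ?_).2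
  · filter_upwards [isOpen_Ioo.mem_nhds ht] with s hs
    exact (slice hf s hs).aestronglyMeasurable
  · exact (slice hf t ht).integrable_of_hasCompactSupport (HasCompactSupport.intro hK (h0 t ht))
  · exact (slice hf' t ht).aestronglyMeasurable
  · refine Eventually.of_forall fun x s hs => ?_
    by_cases hx : x ∈ K
    · rw [indicator_of_mem hx]; exact hM (s, x) ⟨hs, hx⟩
    · rw [indicator_of_notMem hx, h0' s (hball hs) x hx, norm_zero]
  · exact (integrable_indicator_iff hK.measurableSet).2
      (integrableOn_const hK.measure_lt_top.ne)
  · exact Eventually.of_forall fun x s hs => hd s (hball hs) x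

end parametric

section regularity

variable {n : ℕ} {T : ℝ} {E : Type*} [NormedAddCommGroup E] [NormedSpace ℝ E]
  {F : ℝ → Sp n → E}

theorem uniqueDiffOn_strip : UniqueDiffOn ℝ (Ico 0 T ×ˢ (univ : Set (Sp n))) :=
  (uniqueDiffOn_Ico 0 T).prod uniqueDiffOn_univ

theorem strip_mem_nhds {t : ℝ} (ht : t ∈ Ioo 0 T) (x : Sp n) :
    Ico 0 T ×ˢ (univ : Set (Sp n)) ∈ 𝓝 (t, x) :=
  prod_mem_nhds (Ico_mem_nhds ht.1 ht.2) univ_mem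

theorem slice_contDiff (hF : ContDiffOn ℝ 1 (fun q : ℝ × Sp n => F q.1 q.2) (Ico 0 T ×ˢ univ))
    {t : ℝ} (ht : t ∈ Ico 0 T) : ContDiff ℝ 1 (F t) := by
  rw [← contDiffOn_univ]
  exact hF.comp (f := fun x : Sp n => (t, x)) (by fun_prop) fun x _ => ⟨ht, mem_univ _⟩

theorem hasFDerivAt_uncurry
    (hF : ContDiffOn ℝ 1 (fun q : ℝ × Sp n => F q.1 q.2) (Ico 0 T ×ˢ univ))
    {t : ℝ} (ht : t ∈ Ioo 0 T) (x : Sp n) :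
    HasFDerivAt (fun q : ℝ × Sp n => F q.1 q.2)
      (fderivWithin ℝ (fun q : ℝ × Sp n => F q.1 q.2) (Ico 0 T ×ˢ univ) (t, x)) (t, x) :=
  ((hF.differentiableOn one_ne_zero) (t, x)
    ⟨Ioo_subset_Ico_self ht, mem_univ _⟩).hasFDerivWithinAt.hasFDerivAt (strip_mem_nhds ht x)

theorem hasDerivAt_time'
    (hF : ContDiffOn ℝ 1 (fun q : ℝ × Sp n => F q.1 q.2) (Ico 0 T ×ˢ univ))
    {t : ℝ} (ht : t ∈ Ioo 0 T) (x : Sp n) :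
    HasDerivAt (fun s => F s x)
      (fderivWithin ℝ (fun q : ℝ × Sp n => F q.1 q.2) (Ico 0 T ×ˢ univ) (t, x) (1, 0)) t :=
  (hasFDerivAt_uncurry hF ht x).comp_hasDerivAt (f := fun s : ℝ => (s, x)) t
    ((hasDerivAt_id t).prodMk (hasDerivAt_const t x))

theorem hasDerivAt_time
    (hF : ContDiffOn ℝ 1 (fun q : ℝ × Sp n => F q.1 q.2) (Ico 0 T ×ˢ univ))
    {t : ℝ} (ht : t ∈ Ioo 0 T) (x : Sp n) :
    HasDerivAt (fun s => F s x) (deriv (fun s => F s x) t) t :=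
  (hasDerivAt_time' hF ht x).differentiableAt.hasDerivAt

theorem fderiv_slice (hF : ContDiffOn ℝ 1 (fun q : ℝ × Sp n => F q.1 q.2) (Ico 0 T ×ˢ univ))
    {t : ℝ} (ht : t ∈ Ioo 0 T) (x : Sp n) :
    fderiv ℝ (F t) x =
      (fderivWithin ℝ (fun q : ℝ × Sp n => F q.1 q.2) (Ico 0 T ×ˢ univ) (t, x)).comp
        (ContinuousLinearMap.inr ℝ ℝ (Sp n)) :=
  ((hasFDerivAt_uncurry hF ht x).comp x (hasFDerivAt_prodMk_right t x)).fderiv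

theorem continuousOn_deriv_time
    (hF : ContDiffOn ℝ 1 (fun q : ℝ × Sp n => F q.1 q.2) (Ico 0 T ×ˢ univ)) :
    ContinuousOn (fun q : ℝ × Sp n => deriv (fun s => F s q.2) q.1) (Ioo 0 T ×ˢ univ) := by
  have h := hF.continuousOn_fderivWithin uniqueDiffOn_strip le_rfl
  have h2 := (h.mono (prod_mono Ioo_subset_Ico_self subset_rfl)).clm_apply
    (continuousOn_const (c := ((1 : ℝ), (0 : Sp n))))
  exact h2.congr fun q hq => (hasDerivAt_time' hF hq.1 q.2).deriv

/-- First derivatives of a function that is `C¹` up to the initial time are bounded on compact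
sets. -/
theorem exists_bound_derivs
    (hF : ContDiffOn ℝ 1 (fun q : ℝ × Sp n => F q.1 q.2) (Ico 0 T ×ˢ univ))
    {t₁ : ℝ} (ht₁ : t₁ < T) {K : Set (Sp n)} (hK : IsCompact K) :
    ∃ M, 0 ≤ M ∧ ∀ t ∈ Ioo 0 t₁, ∀ x ∈ K, ‖F t x‖ ≤ M ∧ ‖deriv (fun s => F s x) t‖ ≤ M ∧
      ‖fderiv ℝ (F t) x‖ ≤ M := by
  have hsub : Icc 0 t₁ ×ˢ K ⊆ Ico 0 T ×ˢ univ :=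
    prod_mono (fun s hs => ⟨hs.1, hs.2.trans_lt ht₁⟩) (subset_univ _)
  have hc := isCompact_Icc.prod hK (s := Icc 0 t₁)
  obtain ⟨M₀, h₀⟩ := hc.exists_bound_of_continuousOn (hF.continuousOn.mono hsub)
  obtain ⟨M₁, h₁⟩ := hc.exists_bound_of_continuousOn
    ((hF.continuousOn_fderivWithin uniqueDiffOn_strip le_rfl).mono hsub)
  refine ⟨max (max M₀ M₁) 0, le_max_right _ _, fun t ht x hx => ?_⟩
  have ht' : t ∈ Ioo 0 T := ⟨ht.1, ht.2.trans ht₁⟩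
  have hm : (t, x) ∈ Icc 0 t₁ ×ˢ K := ⟨Ioo_subset_Icc_self ht, hx⟩
  have hM₁ : M₁ ≤ max (max M₀ M₁) 0 := (le_max_right _ _).trans (le_max_left _ _)
  refine ⟨(h₀ _ hm).trans ((le_max_left _ _).trans (le_max_left _ _)), ?_, ?_⟩
  · rw [(hasDerivAt_time' hF ht' x).deriv]
    refine (ContinuousLinearMap.le_opNorm _ _).trans ?_
    have : ‖((1 : ℝ), (0 : Sp n))‖ = 1 := by simp [Prod.norm_def]
    rw [this, mul_one]
    exact (h₁ _ hm).trans hM₁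
  · rw [fderiv_slice hF ht' x]
    refine (ContinuousLinearMap.opNorm_comp_le _ _).trans ?_
    refine (mul_le_of_le_one_right (norm_nonneg _) ?_).trans ((h₁ _ hm).trans hM₁)
    exact ContinuousLinearMap.norm_inr_le_one ℝ ℝ (Sp n)

end regularity

section divergence

variable {n : ℕ}

theorem dv_smul {f : Sp n → ℝ} {F : Sp n → Sp n} {x : Sp n} (hf : DifferentiableAt ℝ f x)
    (hF : DifferentiableAt ℝ F x) :
    dv (fun y => f y • F y) x = fderiv ℝ f x (F x) + f x * dv F x := by
  have h : fderiv ℝ (fun y => f y • F y) x = f x • fderiv ℝ F x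
      + (fderiv ℝ f x).smulRight (F x) := fderiv_fun_smul hf hF
  simp only [dv, h, Finset.mul_sum, ← sum_mul_apply_single (fderiv ℝ f x) (F x),
    ← Finset.sum_add_distrib]
  refine Finset.sum_congr rfl fun j _ => ?_
  simp
  ring

theorem dv_add {F G : Sp n → Sp n} {x : Sp n} (hF : DifferentiableAt ℝ F x)
    (hG : DifferentiableAt ℝ G x) : dv (fun y => F y + G y) x = dv F x + dv G x := by
  simp only [dv, fderiv_fun_add hF hG, ← Finset.sum_add_distrib]
  rfl

theorem dv_const (c : Sp n) (x : Sp n) : dv (fun _ => c) x = 0 := by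
  simp [dv]

theorem sum_pd_coord {F : Sp n → Sp n} {x : Sp n} (hF : DifferentiableAt ℝ F x) :
    ∑ j, pd j (fun y => F y j) x = dv F x := by
  simp only [dv, pd, fderiv_apply_coord hF]

theorem sum_mul_pd (f : Sp n → ℝ) (x v : Sp n) : ∑ j, v j * pd j f x = fderiv ℝ f x v :=
  sum_mul_apply_single _ _

theorem abs_dv_le {F : Sp n → Sp n} {x : Sp n} {M : ℝ} (h : ‖fderiv ℝ F x‖ ≤ M) :
    |dv F x| ≤ n * M := by
  refine (Finset.abs_sum_le_sum_abs _ _).trans ?_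
  refine (Finset.sum_le_card_nsmul _ _ M fun j _ => ?_).trans (by simp)
  refine (PiLp.norm_apply_le (fderiv ℝ F x (EuclideanSpace.single j 1)) j).trans ?_
  refine (ContinuousLinearMap.le_opNorm _ _).trans ?_
  simpa using h

end divergence

section weak

variable {n : ℕ} {T : ℝ} {w : Sp n → ℝ} {C : NNReal} {w' : Sp n → Sp n →L[ℝ] ℝ}
  {D : ℝ → Sp n → ℝ} {F : ℝ → Sp n → Sp n}

theorem continuousOn_integral_mul
    (hD : ContinuousOn (fun q : ℝ × Sp n => D q.1 q.2) (Ico 0 T ×ˢ univ))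
    (hw : Continuous w) (hc : HasCompactSupport w) :
    ContinuousOn (fun t => ∫ x, D t x * w x) (Ico 0 T) := by
  refine continuousOn_integral_of_compact_support (k := tsupport w) hc ?_ ?_
  · exact hD.mul (hw.comp continuous_snd).continuousOn
  · intro t x _ hx
    rw [image_eq_zero_of_notMem_tsupport hx, mul_zero]

/-- The weak form of a conservation law. -/
theorem hasDerivAt_integral_of_conservation
    (hD : ContDiffOn ℝ 1 (fun q : ℝ × Sp n => D q.1 q.2) (Ico 0 T ×ˢ univ))
    (hF : ContDiffOn ℝ 1 (fun q : ℝ × Sp n => F q.1 q.2) (Ico 0 T ×ˢ univ))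
    (heq : ∀ t ∈ Ioo 0 T, ∀ x, deriv (fun s => D s x) t + dv (F t) x = 0)
    (hw : LipschitzWith C w) (hc : HasCompactSupport w)
    (hw' : ∀ᵐ x, HasFDerivAt w (w' x) x) {t : ℝ} (ht : t ∈ Ioo 0 T) :
    HasDerivAt (fun s => ∫ x, D s x * w x) (∫ x, w' x (F t x)) t := by
  have hsub : Ioo 0 T ×ˢ (univ : Set (Sp n)) ⊆ Ico 0 T ×ˢ univ :=
    prod_mono Ioo_subset_Ico_self subset_rfl
  have hws : Continuous fun q : ℝ × Sp n => w q.2 := hw.continuous.comp continuous_snd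
  have h := hasDerivAt_integral_of_compact (f := fun s x => D s x * w x)
    (f' := fun s x => deriv (fun s => D s x) s * w x) hc
    ((hD.continuousOn.mono hsub).mul hws.continuousOn)
    ((continuousOn_deriv_time hD).mul hws.continuousOn)
    (fun s hs x => (hasDerivAt_time hD hs x).mul_const _)
    (fun s _ x hx => by rw [image_eq_zero_of_notMem_tsupport hx, mul_zero]) ht
  have e : ∫ x, deriv (fun s => D s x) t * w x = ∫ x, w' x (F t x) := by
    have := (integral_div_mul_eq_neg (slice_contDiff hF (Ioo_subset_Ico_self ht)) hw hc hw').2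
    rw [← neg_eq_iff_eq_neg, ← integral_neg] at this
    rw [← this]
    refine integral_congr_ae (Eventually.of_forall fun x => ?_)
    simp only [eq_neg_of_add_eq_zero_left (heq t ht x)]
    ring
  rwa [e] at h

end weak

/-- The momentum flux `ρ Vᵢ V + p eᵢ`. -/
noncomputable def momentumFlux {n : ℕ} (ρ : ℝ → Sp n → ℝ) (V : ℝ → Sp n → Sp n)
    (p : ℝ → Sp n → ℝ) (i : Fin n) (t : ℝ) (x : Sp n) : Sp n :=
  (ρ t x * V t x i) • V t x + p t x • EuclideanSpace.single i (1 : ℝ)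

/-- The energy density `ρ |V|² / 2 + p / (γ - 1)`. -/
noncomputable def energyDensity {n : ℕ} (γ : ℝ) (ρ : ℝ → Sp n → ℝ) (V : ℝ → Sp n → Sp n)
    (p : ℝ → Sp n → ℝ) (t : ℝ) (x : Sp n) : ℝ :=
  1 / 2 * (ρ t x * ‖V t x‖ ^ 2) + 1 / (γ - 1) * p t x

/-- The energy flux `(ρ |V|² / 2 + γ p / (γ - 1)) V`. -/
noncomputable def energyFlux {n : ℕ} (γ : ℝ) (ρ : ℝ → Sp n → ℝ) (V : ℝ → Sp n → Sp n)
    (p : ℝ → Sp n → ℝ) (t : ℝ) (x : Sp n) : Sp n :=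
  (1 / 2 * (ρ t x * ‖V t x‖ ^ 2) + γ / (γ - 1) * p t x) • V t x

namespace IsClassicalSolution

variable {n : ℕ} {γ T : ℝ} {ρ : ℝ → Sp n → ℝ} {V : ℝ → Sp n → Sp n} {p S : ℝ → Sp n → ℝ}

theorem smooth_coord (h : IsClassicalSolution γ T ρ V p S) (i : Fin n) :
    ContDiffOn ℝ 1 (fun q : ℝ × Sp n => V q.1 q.2 i) (Ico 0 T ×ˢ univ) :=
  (EuclideanSpace.proj (𝕜 := ℝ) i).contDiff.comp_contDiffOn h.smooth_velocity

theorem diff_density (h : IsClassicalSolution γ T ρ V p S)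
    {t : ℝ} (ht : t ∈ Ioo 0 T) : Differentiable ℝ (ρ t) :=
  (slice_contDiff h.smooth_density (Ioo_subset_Ico_self ht)).differentiable one_ne_zero

theorem diff_velocity (h : IsClassicalSolution γ T ρ V p S)
    {t : ℝ} (ht : t ∈ Ioo 0 T) : Differentiable ℝ (V t) :=
  (slice_contDiff h.smooth_velocity (Ioo_subset_Ico_self ht)).differentiable one_ne_zero

theorem diff_pressure (h : IsClassicalSolution γ T ρ V p S)
    {t : ℝ} (ht : t ∈ Ioo 0 T) : Differentiable ℝ (p t) :=
  (slice_contDiff h.smooth_pressure (Ioo_subset_Ico_self ht)).differentiable one_ne_zero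

theorem diff_entropy (h : IsClassicalSolution γ T ρ V p S)
    {t : ℝ} (ht : t ∈ Ioo 0 T) : Differentiable ℝ (S t) :=
  (slice_contDiff h.smooth_entropy (Ioo_subset_Ico_self ht)).differentiable one_ne_zero

theorem diff_coord (h : IsClassicalSolution γ T ρ V p S) {t : ℝ} (ht : t ∈ Ioo 0 T) (i : Fin n) :
    Differentiable ℝ (fun y => V t y i) :=
  (slice_contDiff (F := fun s y => V s y i) (h.smooth_coord i) (Ioo_subset_Ico_self ht)).differentiable one_ne_zero

theorem mass_conservation (h : IsClassicalSolution γ T ρ V p S)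
    {t : ℝ} (ht : t ∈ Ioo 0 T) (x : Sp n) :
    deriv (fun s => ρ s x) t + dv (fun y => ρ t y • V t y) x = 0 := by
  have hd : DifferentiableAt ℝ (fun y => ρ t y • V t y) x :=
    (h.diff_density ht x).smul (h.diff_velocity ht x)
  rw [← h.mass t ht x, ← sum_pd_coord hd]
  rfl

theorem momentum_conservation (h : IsClassicalSolution γ T ρ V p S)
    {t : ℝ} (ht : t ∈ Ioo 0 T) (x : Sp n) (i : Fin n) :
    deriv (fun s => ρ s x * V s x i) t + dv (momentumFlux ρ V p i t) x = 0 := by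
  have h1 : DifferentiableAt ℝ (fun y => (ρ t y * V t y i) • V t y) x :=
    (((h.diff_density ht).mul (h.diff_coord ht i)).smul (h.diff_velocity ht)) x
  have hp := h.diff_pressure ht x
  have e : dv (momentumFlux ρ V p i t) x
      = ∑ j, pd j (fun y => ρ t y * V t y i * V t y j) x + pd i (p t) x := by
    unfold momentumFlux
    rw [dv_add h1 (hp.smul_const _), ← sum_pd_coord h1,
      dv_smul hp (differentiableAt_const _), dv_const]
    simp [pd]
  rw [e, ← add_assoc]
  exact h.momentum t ht x i

theorem mass_transport (h : IsClassicalSolution γ T ρ V p S) {t : ℝ} (ht : t ∈ Ioo 0 T) (x : Sp n) :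
    deriv (fun s => ρ s x) t + fderiv ℝ (ρ t) x (V t x) + ρ t x * dv (V t) x = 0 := by
  rw [← h.mass_conservation ht x, dv_smul (h.diff_density ht x) (h.diff_velocity ht x)]
  ring

theorem deriv_coord (h : IsClassicalSolution γ T ρ V p S)
    {t : ℝ} (ht : t ∈ Ioo 0 T) (x : Sp n) (i : Fin n) :
    deriv (fun s => V s x i) t = (deriv (fun s => V s x) t) i :=
  ((EuclideanSpace.proj (𝕜 := ℝ) i).hasFDerivAt.comp_hasDerivAt t
    (hasDerivAt_time h.smooth_velocity ht x)).deriv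

theorem momentum_transport (h : IsClassicalSolution γ T ρ V p S)
    {t : ℝ} (ht : t ∈ Ioo 0 T) (x : Sp n) (i : Fin n) :
    ρ t x * ((deriv (fun s => V s x) t) i + (fderiv ℝ (V t) x (V t x)) i)
      + fderiv ℝ (p t) x (EuclideanSpace.single i 1) = 0 := by
  have hρ := h.diff_density ht x
  have hV := h.diff_velocity ht x
  have hVi := h.diff_coord ht i x
  have hp := h.diff_pressure ht x
  have hm := h.momentum_conservation ht x i
  have e1 : deriv (fun s => ρ s x * V s x i) t
      = deriv (fun s => ρ s x) t * V t x i + ρ t x * (deriv (fun s => V s x) t) i := by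
    rw [← h.deriv_coord ht]
    exact ((hasDerivAt_time h.smooth_density ht x).mul
      (hasDerivAt_time (F := fun s y => V s y i) (h.smooth_coord i) ht x)).deriv
  have e2 : dv (momentumFlux ρ V p i t) x
      = fderiv ℝ (ρ t) x (V t x) * V t x i + ρ t x * (fderiv ℝ (V t) x (V t x)) i
        + ρ t x * V t x i * dv (V t) x + fderiv ℝ (p t) x (EuclideanSpace.single i 1) := by
    have hm : DifferentiableAt ℝ (fun y => ρ t y * V t y i) x := hρ.mul hVi
    have hm' : DifferentiableAt ℝ (fun y => (ρ t y * V t y i) • V t y) x := hm.smul hV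
    unfold momentumFlux
    rw [dv_add hm' (hp.smul_const _), dv_smul hm hV,
      dv_smul hp (differentiableAt_const _), dv_const]
    have : fderiv ℝ (fun y => ρ t y * V t y i) x
        = ρ t x • fderiv ℝ (fun y => V t y i) x + V t x i • fderiv ℝ (ρ t) x :=
      fderiv_fun_mul hρ hVi
    rw [this]
    simp only [add_apply, smul_apply, smul_eq_mul,
      fderiv_apply_coord hV]
    ring
  rw [e1, e2] at hm
  linear_combination hm - V t x i * h.mass_transport ht x

theorem momentum_inner (h : IsClassicalSolution γ T ρ V p S) {t : ℝ} (ht : t ∈ Ioo 0 T) (x : Sp n) :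
    ρ t x * (inner ℝ (V t x) (deriv (fun s => V s x) t)
      + inner ℝ (V t x) (fderiv ℝ (V t) x (V t x))) + fderiv ℝ (p t) x (V t x) = 0 := by
  rw [← sum_mul_apply_single (fderiv ℝ (p t) x) (V t x)]
  simp only [PiLp.inner_apply, ← Finset.sum_add_distrib, Finset.mul_sum]
  refine Finset.sum_eq_zero fun i _ => ?_
  have := h.momentum_transport ht x i
  simp only [RCLike.inner_apply, conj_trivial]
  linear_combination V t x i * this

theorem entropy_transport (h : IsClassicalSolution γ T ρ V p S)
    {t : ℝ} (ht : t ∈ Ioo 0 T) (x : Sp n) :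
    deriv (fun s => S s x) t + fderiv ℝ (S t) x (V t x) = 0 := by
  rw [← h.entropy t ht x, sum_mul_pd]

theorem pressure_transport (h : IsClassicalSolution γ T ρ V p S)
    (hγ : 1 < γ) {t : ℝ} (ht : t ∈ Ioo 0 T) (x : Sp n) :
    deriv (fun s => p s x) t + fderiv ℝ (p t) x (V t x) + γ * p t x * dv (V t) x = 0 := by
  have hst := h.state t (Ioo_subset_Ico_self ht)
  have e1 : deriv (fun s => p s x) t = Real.exp (S t x) * deriv (fun s => S s x) t * ρ t x ^ γ
      + Real.exp (S t x) * (deriv (fun s => ρ s x) t * γ * ρ t x ^ (γ - 1)) := by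
    have heq : (fun s => p s x) =ᶠ[𝓝 t] fun s => Real.exp (S s x) * ρ s x ^ γ := by
      filter_upwards [isOpen_Ioo.mem_nhds ht] with s hs
      exact h.state s (Ioo_subset_Ico_self hs) x
    rw [heq.deriv_eq]
    exact ((hasDerivAt_time h.smooth_entropy ht x).exp.mul
      ((hasDerivAt_time h.smooth_density ht x).rpow_const (Or.inr hγ.le))).deriv
  have e2 : fderiv ℝ (p t) x (V t x)
      = Real.exp (S t x) * fderiv ℝ (S t) x (V t x) * ρ t x ^ γ
        + Real.exp (S t x) * (γ * ρ t x ^ (γ - 1) * fderiv ℝ (ρ t) x (V t x)) := by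
    have heq : p t = fun y => Real.exp (S t y) * ρ t y ^ γ := funext hst
    have hd := ((h.diff_entropy ht x).hasFDerivAt.exp.mul
      ((h.diff_density ht x).hasFDerivAt.rpow_const (Or.inr hγ.le))).fderiv
    rw [heq]
    refine (congrArg (fun L => L (V t x)) hd).trans ?_
    simp
    ring
  have e3 : ρ t x ^ γ = ρ t x ^ (γ - 1) * ρ t x := by
    rcases (h.density_nonneg t (Ioo_subset_Ico_self ht) x).eq_or_lt with h0 | h0
    · rw [← h0, Real.zero_rpow (by linarith), mul_zero]
    · rw [← Real.rpow_add_one h0.ne']; congr 1; ring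
  rw [e1, e2, hst x, e3]
  linear_combination Real.exp (S t x) * ρ t x ^ (γ - 1) * ρ t x * h.entropy_transport ht x
    + Real.exp (S t x) * γ * ρ t x ^ (γ - 1) * h.mass_transport ht x

theorem smooth_kinetic (h : IsClassicalSolution γ T ρ V p S) :
    ContDiffOn ℝ 1 (fun q : ℝ × Sp n => ρ q.1 q.2 * ‖V q.1 q.2‖ ^ 2) (Ico 0 T ×ˢ univ) :=
  h.smooth_density.mul (h.smooth_velocity.norm_sq ℝ)

theorem smooth_energyDensity (h : IsClassicalSolution γ T ρ V p S) :
    ContDiffOn ℝ 1 (fun q : ℝ × Sp n => energyDensity γ ρ V p q.1 q.2) (Ico 0 T ×ˢ univ) :=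
  (contDiffOn_const.mul h.smooth_kinetic).add (contDiffOn_const.mul h.smooth_pressure)

theorem smooth_energyFlux (h : IsClassicalSolution γ T ρ V p S) :
    ContDiffOn ℝ 1 (fun q : ℝ × Sp n => energyFlux γ ρ V p q.1 q.2) (Ico 0 T ×ˢ univ) :=
  ((contDiffOn_const.mul h.smooth_kinetic).add (contDiffOn_const.mul h.smooth_pressure)).smul
    h.smooth_velocity

theorem smooth_massFlux (h : IsClassicalSolution γ T ρ V p S) :
    ContDiffOn ℝ 1 (fun q : ℝ × Sp n => ρ q.1 q.2 • V q.1 q.2) (Ico 0 T ×ˢ univ) :=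
  h.smooth_density.smul h.smooth_velocity

theorem smooth_momentumFlux (h : IsClassicalSolution γ T ρ V p S) (i : Fin n) :
    ContDiffOn ℝ 1 (fun q : ℝ × Sp n => momentumFlux ρ V p i q.1 q.2) (Ico 0 T ×ˢ univ) :=
  ((h.smooth_density.mul (h.smooth_coord i)).smul h.smooth_velocity).add
    (h.smooth_pressure.smul contDiffOn_const)

theorem energy_conservation (h : IsClassicalSolution γ T ρ V p S)
    (hγ : 1 < γ) {t : ℝ} (ht : t ∈ Ioo 0 T) (x : Sp n) :
    deriv (fun s => energyDensity γ ρ V p s x) t + dv (energyFlux γ ρ V p t) x = 0 := by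
  have hρ := h.diff_density ht x
  have hV := h.diff_velocity ht x
  have hp := h.diff_pressure ht x
  have hρt := hasDerivAt_time h.smooth_density ht x
  have hVt := hasDerivAt_time h.smooth_velocity ht x
  have hpt := hasDerivAt_time h.smooth_pressure ht x
  have e1 : deriv (fun s => energyDensity γ ρ V p s x) t
      = 1 / 2 * (deriv (fun s => ρ s x) t * ‖V t x‖ ^ 2
        + ρ t x * (2 * inner ℝ (V t x) (deriv (fun s => V s x) t)))
        + 1 / (γ - 1) * deriv (fun s => p s x) t :=
    (((hρt.mul hVt.norm_sq).const_mul _).add (hpt.const_mul _)).deriv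
  have hf := ((hρ.hasFDerivAt.mul hV.hasFDerivAt.norm_sq).const_mul (1 / 2 : ℝ)).add
    (hp.hasFDerivAt.const_mul (γ / (γ - 1)))
  have e2 : dv (energyFlux γ ρ V p t) x
      = 1 / 2 * (fderiv ℝ (ρ t) x (V t x) * ‖V t x‖ ^ 2
        + ρ t x * (2 * inner ℝ (V t x) (fderiv ℝ (V t) x (V t x))))
        + γ / (γ - 1) * fderiv ℝ (p t) x (V t x)
        + (1 / 2 * (ρ t x * ‖V t x‖ ^ 2) + γ / (γ - 1) * p t x) * dv (V t) x := by
    unfold energyFlux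
    refine (dv_smul hf.differentiableAt hV).trans ?_
    rw [hf.fderiv]
    simp
    ring
  have hγ' : γ - 1 ≠ 0 := by linarith
  have e3 : γ / (γ - 1) = 1 + 1 / (γ - 1) := by field_simp; ring
  have e4 : γ * (1 / (γ - 1)) = 1 + 1 / (γ - 1) := by field_simp; ring
  rw [e1, e2, e3]
  linear_combination (1 / 2 * ‖V t x‖ ^ 2) * h.mass_transport ht x + h.momentum_inner ht x
    + 1 / (γ - 1) * h.pressure_transport hγ ht x - p t x * dv (V t) x * e4

end IsClassicalSolution

theorem nonpos_of_deriv_le_mul {E E' : ℝ → ℝ} {b C : ℝ} (hb : 0 ≤ b)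
    (hc : ContinuousOn E (Icc 0 b)) (hd : ∀ t ∈ Ioo 0 b, HasDerivAt E (E' t) t)
    (hle : ∀ t ∈ Ioo 0 b, E' t ≤ C * E t) (h0 : E 0 ≤ 0) : E b ≤ 0 := by
  have hder : ∀ t ∈ Ioo 0 b, HasDerivAt (fun t => Real.exp (-C * t) * E t)
      (Real.exp (-C * t) * (-C * 1) * E t + Real.exp (-C * t) * E' t) t := fun t ht =>
    (((hasDerivAt_id t).const_mul (-C)).exp).mul (hd t ht)
  have hanti : AntitoneOn (fun t => Real.exp (-C * t) * E t) (Icc 0 b) := by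
    refine antitoneOn_of_deriv_nonpos (convex_Icc 0 b)
      (ContinuousOn.mul (by fun_prop) hc) ?_ ?_ <;> rw [interior_Icc]
    · exact fun t ht => (hder t ht).differentiableAt.differentiableWithinAt
    · intro t ht
      rw [(hder t ht).deriv]
      have := mul_le_mul_of_nonneg_left (hle t ht) (Real.exp_pos (-C * t)).le
      linarith
  have := hanti (left_mem_Icc.2 hb) (right_mem_Icc.2 hb) hb
  simp only [mul_zero, Real.exp_zero, one_mul] at this
  exact nonpos_of_mul_nonpos_right (this.trans h0) (Real.exp_pos _)

theorem hasDerivAt_max_zero_sq (u : ℝ) :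
    HasDerivAt (fun u : ℝ => max u 0 ^ 2) (2 * max u 0) u := by
  rcases lt_trichotomy u 0 with hu | hu | hu
  · have : (fun u : ℝ => max u 0 ^ 2) =ᶠ[𝓝 u] fun _ => 0 := by
      filter_upwards [gt_mem_nhds hu] with y hy
      simp [max_eq_right hy.le]
    rw [max_eq_right hu.le, mul_zero]
    exact (hasDerivAt_const u (0 : ℝ)).congr_of_eventuallyEq this
  · subst hu
    rw [max_self, mul_zero, hasDerivAt_iff_isLittleO_nhds_zero]
    simp only [zero_add, max_self, smul_zero, sub_zero]
    refine Asymptotics.IsBigO.trans_isLittleO (g := fun h : ℝ => h ^ 2) ?_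
      (Asymptotics.isLittleO_pow_id one_lt_two)
    · refine Asymptotics.isBigO_of_le _ fun y => ?_
      rw [zero_pow two_ne_zero, sub_zero, norm_pow, norm_pow]
      refine pow_le_pow_left₀ (norm_nonneg _) ?_ 2
      simp only [Real.norm_eq_abs]
      rcases le_total y 0 with h | h
      · simp [max_eq_right h]
      · simp [max_eq_left h]
  · have : (fun u : ℝ => max u 0 ^ 2) =ᶠ[𝓝 u] fun u => u ^ 2 := by
      filter_upwards [lt_mem_nhds hu] with y hy
      simp [max_eq_left hy.le]
    rw [max_eq_left hu.le]
    refine HasDerivAt.congr_of_eventuallyEq ?_ this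
    simpa using hasDerivAt_pow 2 u

theorem contDiff_max_zero_sq : ContDiff ℝ 1 (fun u : ℝ => max u 0 ^ 2) := by
  refine contDiff_one_iff_deriv.2 ⟨fun u => (hasDerivAt_max_zero_sq u).differentiableAt, ?_⟩
  rw [show deriv (fun u : ℝ => max u 0 ^ 2) = fun u => 2 * max u 0 from
    funext fun u => (hasDerivAt_max_zero_sq u).deriv]
  fun_prop

/-- A weight supported in the backward cone of slope `c` over the ball of radius `r` about `x₀`. -/
noncomputable def coneWeight {n : ℕ} (c r : ℝ) (x₀ : Sp n) (t : ℝ) (x : Sp n) : ℝ :=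
  max ((r - c * t) ^ 2 - ‖x - x₀‖ ^ 2) 0 ^ 2

section cone

variable {n : ℕ} {c r : ℝ} {x₀ : Sp n}

theorem contDiff_coneWeight : ContDiff ℝ 1 (fun q : ℝ × Sp n => coneWeight c r x₀ q.1 q.2) := by
  refine contDiff_max_zero_sq.comp (f := fun q : ℝ × Sp n => (r - c * q.1) ^ 2 - ‖q.2 - x₀‖ ^ 2) ?_
  exact ((contDiff_const.sub (contDiff_const.mul contDiff_fst)).pow 2).sub
    ((contDiff_snd.sub contDiff_const).norm_sq ℝ)

theorem hasDerivAt_coneWeight (t : ℝ) (x : Sp n) :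
    HasDerivAt (fun s => coneWeight c r x₀ s x)
      (2 * max ((r - c * t) ^ 2 - ‖x - x₀‖ ^ 2) 0 * (2 * (r - c * t) * (-c))) t := by
  have h : HasDerivAt (fun s => (r - c * s) ^ 2 - ‖x - x₀‖ ^ 2) (2 * (r - c * t) * (-c)) t := by
    have := ((((hasDerivAt_id t).const_mul c).const_sub r).pow 2).sub_const (‖x - x₀‖ ^ 2)
    simpa using this
  exact (hasDerivAt_max_zero_sq _).comp t h

theorem fderiv_coneWeight (t : ℝ) (x v : Sp n) :
    fderiv ℝ (coneWeight c r x₀ t) x v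
      = 2 * max ((r - c * t) ^ 2 - ‖x - x₀‖ ^ 2) 0 * (-(2 * inner ℝ (x - x₀) v)) := by
  have h : HasFDerivAt (fun y => (r - c * t) ^ 2 - ‖y - x₀‖ ^ 2)
      (-(2 • (innerSL ℝ (x - x₀)).comp (ContinuousLinearMap.id ℝ (Sp n)))) x :=
    ((hasFDerivAt_id x).sub_const x₀).norm_sq.const_sub _
  have h2 : HasFDerivAt (coneWeight c r x₀ t) _ x :=
    HasDerivAt.comp_hasFDerivAt (h₂ := fun u : ℝ => max u 0 ^ 2) x
      (hasDerivAt_max_zero_sq _) h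
  rw [h2.fderiv]
  simp [-map_sub]

theorem coneWeight_eq_zero {t : ℝ} (h : 0 ≤ c * t) (hr : c * t ≤ r) {x : Sp n}
    (hx : x ∉ closedBall x₀ r) : coneWeight c r x₀ t x = 0 := by
  rw [mem_closedBall, dist_eq_norm, not_le] at hx
  rw [coneWeight, max_eq_right, zero_pow two_ne_zero]
  nlinarith [norm_nonneg (x - x₀)]

end cone

theorem mul_le_sq_add_sq (x y : ℝ) : x * y ≤ x ^ 2 + y ^ 2 := by
  nlinarith [sq_nonneg (x - y), sq_nonneg x, sq_nonneg y]

/-- The error terms in the energy identity are quadratic in the perturbation `(P, N, v)`. -/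
theorem exists_error_bound {γ rb pb c M M' : ℝ} (hγ : 1 < γ) (hrb : 0 < rb) (hpb : 0 < pb)
    (hc : 0 < c) (hcσ : c ^ 2 * rb = γ * pb) (hM : 0 ≤ M) (hM' : 0 ≤ M') :
    ∃ C, ∀ P N v pV rV d A Q pt rt : ℝ, 0 ≤ v → |pV| ≤ M * v → |rV| ≤ M * v → |d| ≤ M' →
      |A| ≤ M * v → |Q| ≤ M * v ^ 2 → |rb + N| ≤ M →
      pt + pV + γ * (pb + P) * d = 0 → rt + rV + (rb + N) * d = 0 →
      (rb + N) * (A + Q) + pV = 0 →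
      P * pt / (γ * pb) + rb * A + (P - c ^ 2 * N) * (pt - c ^ 2 * rt) + (pV + P * d)
        ≤ C * (P ^ 2 / (2 * (γ * pb)) + rb * v ^ 2 / 2 + (P - c ^ 2 * N) ^ 2 / 2) := by
  have hγ0 : 0 < γ := by linarith
  set C₀ := M / (γ * pb) + M' / pb + M * M + 2 * M / c ^ 2 + M + c ^ 2 * M + γ * M' + 2 * M'
    with hC₀
  have hC₀0 : 0 ≤ C₀ := by positivity
  refine ⟨C₀ * (2 * (γ * pb) + 2 / rb + 2), ?_⟩
  intro P N v pV rV d A Q pt rt hv hpV hrV hd hA hQ hρ hpt hrt hmom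
  set a := P - c ^ 2 * N with ha
  set s := P ^ 2 + v ^ 2 + a ^ 2 with hs
  have hs0 : 0 ≤ s := by positivity
  have hN : N = (P - a) / c ^ 2 := by rw [ha]; field_simp; ring
  have hpt' : pt = -pV - γ * (pb + P) * d := by linarith
  have hrt' : rt = -rV - (rb + N) * d := by linarith
  have hid : P * pt / (γ * pb) + rb * A + a * (pt - c ^ 2 * rt) + (pV + P * d)
      = -(P * pV / (γ * pb)) - P ^ 2 * d / pb - (rb + N) * Q - (P - a) * A / c ^ 2
        - a * pV + c ^ 2 * (a * rV) - γ * (a * P * d) + a * (P - a) * d := by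
    have e1 : P * pt / (γ * pb) = -(P * pV / (γ * pb)) - P * d - P ^ 2 * d / pb := by
      rw [hpt']; field_simp; ring
    have e2 : (P - a) * A / c ^ 2 = N * A := by rw [hN]; ring
    have e3 : c ^ 2 * N = P - a := by rw [ha]; ring
    rw [e1, e2, hrt', hpt']
    linear_combination hmom + a * d * hcσ + a * d * e3
  have hPs : P ^ 2 ≤ s := by linarith [sq_nonneg v, sq_nonneg a]
  have hvs : v ^ 2 ≤ s := by linarith [sq_nonneg P, sq_nonneg a]
  have has : a ^ 2 ≤ s := by linarith [sq_nonneg v, sq_nonneg P]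
  have hPv : |P| * v ≤ s := by
    have := mul_le_sq_add_sq |P| v
    rw [sq_abs] at this; linarith [sq_nonneg a]
  have hav : |a| * v ≤ s := by
    have := mul_le_sq_add_sq |a| v
    rw [sq_abs] at this; linarith [sq_nonneg P]
  have haP : |a| * |P| ≤ s := by
    have := mul_le_sq_add_sq |a| |P|
    rw [sq_abs, sq_abs] at this; linarith [sq_nonneg v]
  have t1 : |P * pV| ≤ M * s := by
    rw [abs_mul]
    calc |P| * |pV| ≤ |P| * (M * v) := by gcongr
      _ = M * (|P| * v) := by ring
      _ ≤ M * s := by gcongr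
  have t2 : |P ^ 2 * d| ≤ M' * s := by
    rw [abs_mul, abs_of_nonneg (sq_nonneg P), mul_comm]
    gcongr
  have t3 : |(rb + N) * Q| ≤ M * M * s := by
    rw [abs_mul, mul_assoc]
    calc |rb + N| * |Q| ≤ M * (M * v ^ 2) := by gcongr
      _ ≤ M * (M * s) := by gcongr
  have t4 : |(P - a) * A| ≤ 2 * M * s := by
    rw [abs_mul]
    calc |P - a| * |A| ≤ (|P| + |a|) * (M * v) := by
          gcongr; exact abs_sub P a
      _ = M * (|P| * v) + M * (|a| * v) := by ring
      _ ≤ M * s + M * s := by gcongr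
      _ = 2 * M * s := by ring
  have t5 : |a * pV| ≤ M * s := by
    rw [abs_mul]
    calc |a| * |pV| ≤ |a| * (M * v) := by gcongr
      _ = M * (|a| * v) := by ring
      _ ≤ M * s := by gcongr
  have t6 : |a * rV| ≤ M * s := by
    rw [abs_mul]
    calc |a| * |rV| ≤ |a| * (M * v) := by gcongr
      _ = M * (|a| * v) := by ring
      _ ≤ M * s := by gcongr
  have t7 : |a * P * d| ≤ M' * s := by
    rw [abs_mul, abs_mul, mul_comm]
    gcongr
  have t8 : |a * (P - a) * d| ≤ 2 * M' * s := by
    rw [abs_mul, abs_mul]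
    have h2 : |a| * |P - a| ≤ 2 * s := by
      calc |a| * |P - a| ≤ |a| * (|P| + |a|) := by gcongr; exact abs_sub P a
        _ = |a| * |P| + a ^ 2 := by rw [mul_add, ← sq, sq_abs]
        _ ≤ s + s := add_le_add haP has
        _ = 2 * s := by ring
    calc |a| * |P - a| * |d| ≤ 2 * s * M' := by gcongr
      _ = 2 * M' * s := by ring
  have hle : P * pt / (γ * pb) + rb * A + a * (pt - c ^ 2 * rt) + (pV + P * d) ≤ C₀ * s := by
    rw [hid]
    have u1 : -(P * pV / (γ * pb)) ≤ M * s / (γ * pb) := by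
      rw [← neg_div]; gcongr; exact (neg_le_abs _).trans t1
    have u2 : -(P ^ 2 * d / pb) ≤ M' * s / pb := by
      rw [← neg_div]; gcongr; exact (neg_le_abs _).trans t2
    have u4 : -((P - a) * A / c ^ 2) ≤ 2 * M * s / c ^ 2 := by
      rw [← neg_div]; gcongr; exact (neg_le_abs _).trans t4
    have u6 : c ^ 2 * (a * rV) ≤ c ^ 2 * (M * s) := by
      exact mul_le_mul_of_nonneg_left ((le_abs_self _).trans t6) (sq_nonneg c)
    have u7 : γ * -(a * P * d) ≤ γ * (M' * s) := by
      exact mul_le_mul_of_nonneg_left ((neg_le_abs _).trans t7) hγ0.le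
    have e : C₀ * s = M * s / (γ * pb) + M' * s / pb + M * M * s + 2 * M * s / c ^ 2 + M * s
        + c ^ 2 * (M * s) + γ * (M' * s) + 2 * M' * s := by rw [hC₀]; ring
    rw [e]
    linarith [neg_le_abs ((rb + N) * Q), neg_le_abs (a * pV), le_abs_self (a * (P - a) * d)]
  refine hle.trans ?_
  rw [mul_assoc]
  refine mul_le_mul_of_nonneg_left ?_ hC₀0
  set e := P ^ 2 / (2 * (γ * pb)) + rb * v ^ 2 / 2 + a ^ 2 / 2 with he
  have k1 : 0 ≤ P ^ 2 / (2 * (γ * pb)) := by positivity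
  have k2 : 0 ≤ rb * v ^ 2 / 2 := by positivity
  have k3 : 0 ≤ a ^ 2 / 2 := by positivity
  have l1 : P ^ 2 ≤ 2 * (γ * pb) * e := by
    calc P ^ 2 = 2 * (γ * pb) * (P ^ 2 / (2 * (γ * pb))) := by field_simp
      _ ≤ _ := by gcongr; linarith
  have l2 : v ^ 2 ≤ 2 / rb * e := by
    calc v ^ 2 = 2 / rb * (rb * v ^ 2 / 2) := by field_simp
      _ ≤ _ := by gcongr; linarith
  rw [hs]
  linarith

/-- The quadratic energy density of the perturbation of the state `(rb, 0, pb)`. -/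
noncomputable def perturbEnergy {n : ℕ} (γ rb pb c : ℝ) (ρ : ℝ → Sp n → ℝ)
    (V : ℝ → Sp n → Sp n) (p : ℝ → Sp n → ℝ) (t : ℝ) (x : Sp n) : ℝ :=
  (p t x - pb) ^ 2 / (2 * (γ * pb)) + rb * ‖V t x‖ ^ 2 / 2
    + ((p t x - pb) - c ^ 2 * (ρ t x - rb)) ^ 2 / 2

namespace IsClassicalSolution

variable {n : ℕ} {γ T rb pb c : ℝ} {ρ : ℝ → Sp n → ℝ} {V : ℝ → Sp n → Sp n}
  {p S : ℝ → Sp n → ℝ}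

theorem smooth_perturbEnergy (h : IsClassicalSolution γ T ρ V p S) : ContDiffOn ℝ 1
    (fun q : ℝ × Sp n => perturbEnergy γ rb pb c ρ V p q.1 q.2) (Ico 0 T ×ˢ univ) := by
  have hp := h.smooth_pressure.sub (contDiffOn_const (c := pb))
  have hr := h.smooth_density.sub (contDiffOn_const (c := rb))
  exact (((hp.pow 2).div_const _).add
    ((contDiffOn_const.mul (h.smooth_velocity.norm_sq ℝ)).div_const _)).add
    (((hp.sub (contDiffOn_const.mul hr)).pow 2).div_const _)

theorem smooth_perturbFlux (h : IsClassicalSolution γ T ρ V p S) : ContDiffOn ℝ 1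
    (fun q : ℝ × Sp n => (p q.1 q.2 - pb) • V q.1 q.2) (Ico 0 T ×ˢ univ) :=
  (h.smooth_pressure.sub contDiffOn_const).smul h.smooth_velocity

theorem exists_perturbEnergy_bound (h : IsClassicalSolution γ T ρ V p S)
    (hγ : 1 < γ) (hrb : 0 < rb) (hpb : 0 < pb)
    (hc : 0 < c) (hcσ : c ^ 2 * rb = γ * pb) {t₁ : ℝ} (ht₁ : t₁ < T) {K : Set (Sp n)}
    (hK : IsCompact K) :
    ∃ C, ∀ t ∈ Ioo 0 t₁, ∀ x ∈ K,
      deriv (fun s => perturbEnergy γ rb pb c ρ V p s x) t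
        + dv (fun y => (p t y - pb) • V t y) x ≤ C * perturbEnergy γ rb pb c ρ V p t x := by
  obtain ⟨M₁, hM₁, b₁⟩ := exists_bound_derivs h.smooth_density ht₁ hK
  obtain ⟨M₂, hM₂, b₂⟩ := exists_bound_derivs h.smooth_velocity ht₁ hK
  obtain ⟨M₃, hM₃, b₃⟩ := exists_bound_derivs h.smooth_pressure ht₁ hK
  obtain ⟨C, hC⟩ := exists_error_bound (M := M₁ + M₂ + M₃) (M' := n * (M₁ + M₂ + M₃)) hγ hrb
    hpb hc hcσ (by positivity) (by positivity)
  refine ⟨C, fun t ht x hx => ?_⟩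
  have ht' : t ∈ Ioo 0 T := ⟨ht.1, ht.2.trans ht₁⟩
  obtain ⟨r0, r1, r2⟩ := b₁ t ht x hx
  obtain ⟨v0, v1, v2⟩ := b₂ t ht x hx
  obtain ⟨p0, p1, p2⟩ := b₃ t ht x hx
  have hpt := hasDerivAt_time h.smooth_pressure ht' x
  have hrt := hasDerivAt_time h.smooth_density ht' x
  have hVt := hasDerivAt_time h.smooth_velocity ht' x
  have e1 : deriv (fun s => perturbEnergy γ rb pb c ρ V p s x) t
      = (p t x - pb) * deriv (fun s => p s x) t / (γ * pb)
        + rb * inner ℝ (V t x) (deriv (fun s => V s x) t)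
        + ((p t x - pb) - c ^ 2 * (ρ t x - rb))
          * (deriv (fun s => p s x) t - c ^ 2 * deriv (fun s => ρ s x) t) := by
    have hP := hpt.sub_const pb
    have hN := hrt.sub_const rb
    have := ((((hP.pow 2).div_const (2 * (γ * pb))).add
      ((hVt.norm_sq.const_mul rb).div_const 2)).add
      (((hP.sub (hN.const_mul (c ^ 2))).pow 2).div_const 2)).deriv
    refine this.trans ?_
    simp only [Nat.cast_ofNat, Pi.sub_apply]
    have : γ ≠ 0 := by linarith
    field_simp
    ring
  have e2 : dv (fun y => (p t y - pb) • V t y) x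
      = fderiv ℝ (p t) x (V t x) + (p t x - pb) * dv (V t) x := by
    rw [dv_smul ((h.diff_pressure ht' x).sub_const pb) (h.diff_velocity ht' x),
      fderiv_sub_const]
  have hM : ∀ {m a b : ℝ}, m ≤ M₁ + M₂ + M₃ → a ≤ m * b → 0 ≤ b → a ≤ (M₁ + M₂ + M₃) * b :=
    fun h1 h2 h3 => h2.trans (mul_le_mul_of_nonneg_right h1 h3)
  rw [e1, e2]
  refine hC (p t x - pb) (ρ t x - rb) ‖V t x‖ (fderiv ℝ (p t) x (V t x))
    (fderiv ℝ (ρ t) x (V t x)) (dv (V t) x) (inner ℝ (V t x) (deriv (fun s => V s x) t))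
    (inner ℝ (V t x) (fderiv ℝ (V t) x (V t x))) _ _ (norm_nonneg _) ?_ ?_ ?_ ?_ ?_ ?_ ?_ ?_ ?_
  · exact hM (by linarith) ((fderiv ℝ (p t) x).le_of_opNorm_le p2 _) (norm_nonneg _)
  · exact hM (by linarith) ((fderiv ℝ (ρ t) x).le_of_opNorm_le r2 _) (norm_nonneg _)
  · exact abs_dv_le (by linarith)
  · refine hM (m := M₂) (by linarith) ?_ (norm_nonneg _)
    refine (abs_real_inner_le_norm _ _).trans ?_
    rw [mul_comm]
    gcongr
  · refine hM (m := M₂) (by linarith) ?_ (sq_nonneg _)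
    refine (abs_real_inner_le_norm _ _).trans ?_
    calc ‖V t x‖ * ‖fderiv ℝ (V t) x (V t x)‖ ≤ ‖V t x‖ * (M₂ * ‖V t x‖) := by
          gcongr; exact (fderiv ℝ (V t) x).le_of_opNorm_le v2 _
      _ = M₂ * ‖V t x‖ ^ 2 := by ring
  · rw [add_sub_cancel]; exact r0.trans (by linarith)
  · rw [add_sub_cancel]; exact h.pressure_transport hγ ht' x
  · rw [add_sub_cancel]; exact h.mass_transport ht' x
  · rw [add_sub_cancel]; exact h.momentum_inner ht' x

theorem abs_mul_norm_le_perturbEnergy (hγ : 1 < γ) (hrb : 0 < rb) (hpb : 0 < pb) (hc : 0 < c)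
    (hcσ : c ^ 2 * rb = γ * pb) (t : ℝ) (x : Sp n) :
    |p t x - pb| * ‖V t x‖ ≤ c * perturbEnergy γ rb pb c ρ V p t x := by
  have hg : 0 < γ * pb := by positivity
  have h1 : c * ((p t x - pb) ^ 2 / (2 * (γ * pb)) + rb * ‖V t x‖ ^ 2 / 2)
      - |p t x - pb| * ‖V t x‖ = (|p t x - pb| - c * rb * ‖V t x‖) ^ 2 / (2 * (c * rb)) := by
    rw [← hcσ, ← sq_abs (p t x - pb)]
    field_simp
    ring
  have h2 : 0 ≤ (|p t x - pb| - c * rb * ‖V t x‖) ^ 2 / (2 * (c * rb)) := by positivity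
  have h3 : 0 ≤ c * (((p t x - pb) - c ^ 2 * (ρ t x - rb)) ^ 2 / 2) := by positivity
  unfold perturbEnergy
  linarith

theorem perturbEnergy_nonneg (hγ : 1 < γ) (hrb : 0 < rb) (hpb : 0 < pb)
    (t : ℝ) (x : Sp n) : 0 ≤ perturbEnergy γ rb pb c ρ V p t x := by
  have hg : 0 < γ * pb := by positivity
  unfold perturbEnergy
  positivity

/-- Perturbations of a constant state propagate at most with the sound speed of that state. -/
theorem finite_speed (h : IsClassicalSolution γ T ρ V p S)
    (hγ : 1 < γ) (hrb : 0 < rb) (hpb : 0 < pb) (hc : 0 < c)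
    (hcσ : c ^ 2 * rb = γ * pb) {R0 : ℝ}
    (h0 : ∀ x, R0 ≤ ‖x‖ → ρ 0 x = rb ∧ V 0 x = 0 ∧ p 0 x = pb)
    {t₀ : ℝ} (ht₀ : t₀ ∈ Ico 0 T) {x₀ : Sp n} (hx₀ : R0 + c * t₀ < ‖x₀‖) :
    ρ t₀ x₀ = rb ∧ V t₀ x₀ = 0 ∧ p t₀ x₀ = pb := by
  set r := ‖x₀‖ - R0 with hr
  have hct₀ : 0 ≤ c * t₀ := mul_nonneg hc.le ht₀.1
  have hrt : c * t₀ < r := by linarith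
  set e := perturbEnergy γ rb pb c ρ V p with he
  set η : ℝ → Sp n → ℝ := coneWeight c r x₀ with hη
  have hK : IsCompact (closedBall x₀ r) := isCompact_closedBall x₀ r
  have he0 : ∀ t x, 0 ≤ e t x := perturbEnergy_nonneg hγ hrb hpb
  have hD : ContDiffOn ℝ 1 (fun q : ℝ × Sp n => η q.1 q.2 * e q.1 q.2) (Ico 0 T ×ˢ univ) :=
    contDiff_coneWeight.contDiffOn.mul h.smooth_perturbEnergy
  have hcone : ∀ t ∈ Icc 0 t₀, 0 ≤ c * t ∧ c * t < r := fun t ht =>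
    ⟨mul_nonneg hc.le ht.1, (mul_le_mul_of_nonneg_left ht.2 hc.le).trans_lt hrt⟩
  have hη0 : ∀ t ∈ Icc 0 t₀, ∀ x ∉ closedBall x₀ r, η t x = 0 := fun t ht x hx =>
    coneWeight_eq_zero (hcone t ht).1 (hcone t ht).2.le hx
  have hsub : Icc 0 t₀ ⊆ Ico 0 T := fun t ht => ⟨ht.1, ht.2.trans_lt ht₀.2⟩
  have hsub' : Ioo 0 t₀ ⊆ Ioo 0 T := fun t ht => ⟨ht.1, ht.2.trans ht₀.2⟩
  obtain ⟨C, hC⟩ := h.exists_perturbEnergy_bound hγ hrb hpb hc hcσ ht₀.2 hK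
  have hcontE : ContinuousOn (fun t => ∫ x, η t x * e t x) (Icc 0 t₀) := by
    refine continuousOn_integral_of_compact_support hK
      (hD.continuousOn.mono (prod_mono hsub subset_rfl)) ?_
    intro t x ht hx
    rw [hη0 t ht x hx, zero_mul]
  have hderE : ∀ t ∈ Ioo 0 t₀, HasDerivAt (fun t => ∫ x, η t x * e t x)
      (∫ x, deriv (fun s => η s x * e s x) t) t := by
    intro t ht
    refine hasDerivAt_integral_of_compact hK
      (hD.continuousOn.mono (prod_mono (Ioo_subset_Icc_self.trans hsub) subset_rfl))
      ((continuousOn_deriv_time (F := fun t x => η t x * e t x) hD).mono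
        (prod_mono hsub' subset_rfl))
      (fun s hs x => hasDerivAt_time (F := fun t x => η t x * e t x) hD (hsub' hs) x) ?_ ht
    intro s hs x hx
    rw [hη0 s (Ioo_subset_Icc_self hs) x hx, zero_mul]
  have hleE : ∀ t ∈ Ioo 0 t₀, ∫ x, deriv (fun s => η s x * e s x) t ≤ C * ∫ x, η t x * e t x := by
    intro t ht
    have ht1 := Ioo_subset_Icc_self ht
    have ht2 := hsub' ht
    have hηs : ContDiff ℝ 1 (η t) :=
      contDiff_coneWeight.comp (f := fun x : Sp n => (t, x)) (by fun_prop)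
    have hηc : HasCompactSupport (η t) := HasCompactSupport.intro hK (hη0 t ht1)
    obtain ⟨L, hL⟩ := hηs.lipschitzWith_of_hasCompactSupport hηc one_ne_zero
    have hFs : ContDiff ℝ 1 (fun y => (p t y - pb) • V t y) :=
      slice_contDiff (F := fun t y => (p t y - pb) • V t y) h.smooth_perturbFlux (hsub ht1)
    obtain ⟨hi, hibp⟩ := integral_div_mul_eq_neg hFs hL hηc
      (Eventually.of_forall fun x => ((hηs.differentiable one_ne_zero) x).hasFDerivAt)
    have hes : Continuous (e t) :=
      (slice_contDiff (F := e) h.smooth_perturbEnergy (hsub ht1)).continuous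
    have hiE : Integrable (fun x => C * (η t x * e t x)) :=
      ((hηs.continuous.mul hes).integrable_of_hasCompactSupport hηc.mul_right).const_mul C
    have hdvc : Continuous (dv (fun y => (p t y - pb) • V t y)) := by
      unfold dv
      refine continuous_finsetSum _ fun j _ => ?_
      exact (EuclideanSpace.proj (𝕜 := ℝ) j).continuous.comp
        ((hFs.continuous_fderiv one_ne_zero).clm_apply continuous_const)
    have hidv : Integrable (fun x => dv (fun y => (p t y - pb) • V t y) x * η t x) :=
      (hdvc.mul hηs.continuous).integrable_of_hasCompactSupport hηc.mul_left
    have hpt : ∀ x, deriv (fun s => η s x * e s x) t ≤ C * (η t x * e t x)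
        - (dv (fun y => (p t y - pb) • V t y) x * η t x
          + fderiv ℝ (η t) x ((p t x - pb) • V t x)) := by
      intro x
      have hηt := hasDerivAt_coneWeight (c := c) (r := r) (x₀ := x₀) t x
      have het := hasDerivAt_time (F := e) h.smooth_perturbEnergy ht2 x
      have e1 : deriv (fun s => η s x * e s x) t
          = 2 * max ((r - c * t) ^ 2 - ‖x - x₀‖ ^ 2) 0 * (2 * (r - c * t) * (-c)) * e t x
            + η t x * deriv (fun s => e s x) t := (hηt.mul het).deriv
      rw [e1, hη, fderiv_coneWeight, ← hη, inner_smul_right]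
      have hη1 : 0 ≤ η t x := sq_nonneg _
      have b1 : η t x * (deriv (fun s => e s x) t + dv (fun y => (p t y - pb) • V t y) x)
          ≤ η t x * (C * e t x) := by
        by_cases hx : x ∈ closedBall x₀ r
        · exact mul_le_mul_of_nonneg_left (hC t ht x hx) hη1
        · simp [hη0 t ht1 x hx]
      have b2 : 0 ≤ max ((r - c * t) ^ 2 - ‖x - x₀‖ ^ 2) 0
          * ((r - c * t) * (c * e t x) + (p t x - pb) * inner ℝ (x - x₀) (V t x)) := by
        rcases le_total ((r - c * t) ^ 2 - ‖x - x₀‖ ^ 2) 0 with hm | hm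
        · rw [max_eq_right hm, zero_mul]
        · refine mul_nonneg (le_max_right _ _) ?_
          have hrc : 0 ≤ r - c * t := by linarith [(hcone t ht1).2]
          have hxr : ‖x - x₀‖ ≤ r - c * t :=
            le_of_sq_le_sq (by linarith) hrc
          have k1 : |(p t x - pb) * inner ℝ (x - x₀) (V t x)| ≤ (r - c * t) * (c * e t x) := by
            rw [abs_mul]
            calc |p t x - pb| * |inner ℝ (x - x₀) (V t x)|
                ≤ |p t x - pb| * (‖x - x₀‖ * ‖V t x‖) := by
                  gcongr; exact abs_real_inner_le_norm _ _
              _ = ‖x - x₀‖ * (|p t x - pb| * ‖V t x‖) := by ring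
              _ ≤ (r - c * t) * (c * e t x) := by
                  exact mul_le_mul hxr
                    (abs_mul_norm_le_perturbEnergy hγ hrb hpb hc hcσ t x) (by positivity) hrc
          linarith [neg_abs_le ((p t x - pb) * inner ℝ (x - x₀) (V t x))]
      linarith
    have hsum : Integrable (fun x => dv (fun y => (p t y - pb) • V t y) x * η t x
          + fderiv ℝ (η t) x ((p t x - pb) • V t x)) := hidv.add hi
    have hider : Integrable (fun x => deriv (fun s => η s x * e s x) t) := by
      have hc' := continuousOn_deriv_time (F := fun t x => η t x * e t x) hD
      have hcont : Continuous (fun x => deriv (fun s => η s x * e s x) t) := by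
        rw [← continuousOn_univ]
        exact hc'.comp (f := fun x : Sp n => (t, x)) (by fun_prop) fun x _ => ⟨ht2, mem_univ _⟩
      refine hcont.integrable_of_hasCompactSupport (HasCompactSupport.intro hK fun x hx => ?_)
      have : (fun s => η s x * e s x) =ᶠ[𝓝 t] fun _ => 0 := by
        filter_upwards [isOpen_Ioo.mem_nhds ht] with s hs
        rw [hη0 s (Ioo_subset_Icc_self hs) x hx, zero_mul]
      rw [this.deriv_eq, deriv_const]
    refine (integral_mono hider (hiE.sub hsum) hpt).trans ?_
    rw [integral_sub' hiE hsum, integral_add hidv hi, hibp, neg_add_cancel, sub_zero,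
      integral_const_mul]
  have hinit : (∫ x, η 0 x * e 0 x) ≤ 0 := by
    refine integral_nonpos fun x => ?_
    by_cases hx : x ∈ closedBall x₀ r
    · have hx' : R0 ≤ ‖x‖ := by
        rw [mem_closedBall, dist_eq_norm] at hx
        have := norm_sub_norm_le x₀ x
        rw [norm_sub_rev] at this
        linarith
      obtain ⟨a1, a2, a3⟩ := h0 x hx'
      simp [he, perturbEnergy, a1, a2, a3]
    · simp [hη0 0 (left_mem_Icc.2 ht₀.1) x hx]
  have hfin := nonpos_of_deriv_le_mul ht₀.1 hcontE hderE hleE hinit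
  have hmem : t₀ ∈ Icc 0 t₀ := right_mem_Icc.2 ht₀.1
  have hcont : Continuous (fun x => η t₀ x * e t₀ x) :=
    (slice_contDiff (F := fun t x => η t x * e t x) hD ht₀).continuous
  have hnn : 0 ≤ fun x => η t₀ x * e t₀ x := fun x => mul_nonneg (sq_nonneg _) (he0 _ _)
  have hint : Integrable (fun x => η t₀ x * e t₀ x) :=
    hcont.integrable_of_hasCompactSupport
      (HasCompactSupport.intro hK fun x hx => by rw [hη0 t₀ hmem x hx, zero_mul])
  have hz : (fun x => η t₀ x * e t₀ x) = 0 := by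
    have hae := (integral_eq_zero_iff_of_nonneg hnn hint).1
      (le_antisymm hfin (integral_nonneg hnn))
    exact Continuous.ae_eq_iff_eq volume hcont continuous_zero |>.1 hae
  have hzx : η t₀ x₀ * e t₀ x₀ = 0 := congrFun hz x₀
  have hηpos : 0 < η t₀ x₀ := by
    have : 0 < (r - c * t₀) ^ 2 := pow_pos (by linarith) 2
    simp only [hη, coneWeight, sub_self, norm_zero]
    rw [max_eq_left (by simpa using this.le)]
    simp only [ne_eq, OfNat.ofNat_ne_zero, not_false_eq_true, zero_pow, sub_zero]
    positivity
  have hez : e t₀ x₀ = 0 := (mul_eq_zero.1 hzx).resolve_left hηpos.ne'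
  have hg : 0 < γ * pb := by positivity
  have k1 : 0 ≤ (p t₀ x₀ - pb) ^ 2 / (2 * (γ * pb)) := by positivity
  have k2 : 0 ≤ rb * ‖V t₀ x₀‖ ^ 2 / 2 := by positivity
  have k3 : 0 ≤ ((p t₀ x₀ - pb) - c ^ 2 * (ρ t₀ x₀ - rb)) ^ 2 / 2 := by positivity
  simp only [he, perturbEnergy] at hez
  have z1 : p t₀ x₀ - pb = 0 := by
    have : (p t₀ x₀ - pb) ^ 2 / (2 * (γ * pb)) = 0 := by linarith
    have h2 := (div_eq_zero_iff.1 this).resolve_right (by positivity)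
    exact pow_eq_zero_iff two_ne_zero |>.1 h2
  have z2 : ‖V t₀ x₀‖ = 0 := by
    have : rb * ‖V t₀ x₀‖ ^ 2 = 0 := by linarith
    exact pow_eq_zero_iff two_ne_zero |>.1 ((mul_eq_zero.1 this).resolve_left hrb.ne')
  have z3 : ρ t₀ x₀ - rb = 0 := by
    have : ((p t₀ x₀ - pb) - c ^ 2 * (ρ t₀ x₀ - rb)) ^ 2 = 0 := by linarith
    rw [z1, zero_sub, neg_sq, pow_eq_zero_iff two_ne_zero] at this
    exact (mul_eq_zero.1 this).resolve_left (by positivity)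
  exact ⟨sub_eq_zero.1 z3, norm_eq_zero.1 z2, sub_eq_zero.1 z1⟩

end IsClassicalSolution

section conserved

variable {n : ℕ} {T Db L t₁ : ℝ} {D : ℝ → Sp n → ℝ} {F : ℝ → Sp n → Sp n}

theorem integral_sub_const_eq_of_conservation
    (hD : ContDiffOn ℝ 1 (fun q : ℝ × Sp n => D q.1 q.2) (Ico 0 T ×ˢ univ))
    (hF : ContDiffOn ℝ 1 (fun q : ℝ × Sp n => F q.1 q.2) (Ico 0 T ×ˢ univ))
    (heq : ∀ t ∈ Ioo 0 T, ∀ x, deriv (fun s => D s x) t + dv (F t) x = 0)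
    (ht₁ : t₁ ∈ Ico 0 T)
    (hDfar : ∀ t ∈ Icc 0 t₁, ∀ x, L < ‖x‖ → D t x = Db)
    (hFfar : ∀ t ∈ Icc 0 t₁, ∀ x, L < ‖x‖ → F t x = 0) :
    ∫ x, (D t₁ x - Db) = ∫ x, (D 0 x - Db) := by
  rcases ht₁.1.eq_or_lt with h0 | h0
  · rw [← h0]
  obtain ⟨χ, hχ, hχc, hχ1⟩ := exists_cutoff (closedBall (0 : Sp n) L) (isCompact_closedBall _ _)
  have hsub : Icc 0 t₁ ⊆ Ico 0 T := fun t ht => ⟨ht.1, ht.2.trans_lt ht₁.2⟩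
  obtain ⟨C, hC⟩ := hχ.lipschitzWith_of_hasCompactSupport hχc one_ne_zero
  have hder : ∀ t ∈ Ioo 0 t₁, HasDerivAt (fun s => ∫ x, D s x * χ x) 0 t := by
    intro t ht
    have h := hasDerivAt_integral_of_conservation hD hF heq hC hχc
      (Eventually.of_forall fun x => ((hχ.differentiable one_ne_zero) x).hasFDerivAt)
      ⟨ht.1, ht.2.trans ht₁.2⟩
    have e : ∀ x, fderiv ℝ χ x (F t x) = 0 := by
      intro x
      rcases le_or_gt ‖x‖ L with hx | hx
      · rw [(hχ1 x (by simpa using hx)).fderiv_eq, fderiv_one]; simp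
      · rw [hFfar t (Ioo_subset_Icc_self ht) x hx, map_zero]
    simpa [e] using h
  obtain ⟨s, -, hs⟩ := exists_hasDerivAt_eq_slope _ _ h0
    ((continuousOn_integral_mul hD.continuousOn hχ.continuous hχc).mono hsub) hder
  have hconst : ∫ x, D t₁ x * χ x = ∫ x, D 0 x * χ x := by
    rw [eq_comm, div_eq_zero_iff] at hs
    exact sub_eq_zero.1 (hs.resolve_right (by linarith))
  have key : ∀ t ∈ Icc 0 t₁, ∫ x, (D t x - Db) = (∫ x, D t x * χ x) - ∫ x, Db * χ x := by
    intro t ht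
    rw [← integral_sub]
    · refine integral_congr_ae (Eventually.of_forall fun x => ?_)
      rcases le_or_gt ‖x‖ L with hx | hx
      · have : χ x = 1 := (hχ1 x (by simpa using hx)).eq_of_nhds
        simp [this]
      · simp [hDfar t ht x hx]
    · exact ((slice_contDiff hD (hsub ht)).continuous.mul
        hχ.continuous).integrable_of_hasCompactSupport hχc.mul_left
    · exact (continuous_const.mul hχ.continuous).integrable_of_hasCompactSupport hχc.mul_left
  rw [key t₁ (right_mem_Icc.2 ht₁.1), key 0 (left_mem_Icc.2 ht₁.1), hconst]

theorem volume_real_closedBall (hL : 0 ≤ L) :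
    volume.real (closedBall (0 : Sp n) L) = unitBallVolume n * L ^ n := by
  rw [Measure.addHaar_real_closedBall volume _ hL, unitBallVolume, finrank_euclideanSpace_fin,
    mul_comm]

theorem setIntegral_closedBall_eq {f : Sp n → ℝ} (hf : Continuous f) (hL : 0 ≤ L)
    (hfar : ∀ x, L < ‖x‖ → f x = Db) :
    ∫ x in closedBall 0 L, f x = (∫ x, (f x - Db)) + Db * unitBallVolume n * L ^ n := by
  have hcb := isCompact_closedBall (0 : Sp n) L
  rw [← setIntegral_eq_integral_of_forall_compl_eq_zero (s := closedBall 0 L)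
    (f := fun x => f x - Db), integral_sub (hf.continuousOn.integrableOn_compact hcb)
    (integrableOn_const hcb.measure_lt_top.ne)]
  · rw [setIntegral_const, volume_real_closedBall hL, smul_eq_mul]
    ring
  · intro x hx
    rw [hfar x (by simpa using hx), sub_self]

end conserved

namespace IsClassicalSolution

variable {n : ℕ} {γ T : ℝ} {ρ : ℝ → Sp n → ℝ} {V : ℝ → Sp n → Sp n}
  {p S : ℝ → Sp n → ℝ}

/-- The minimum principle for the entropy. -/
theorem le_entropy (h : IsClassicalSolution γ T ρ V p S) {m L t₁ : ℝ} (ht₁ : t₁ ∈ Ico 0 T)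
    (hfar : ∀ t ∈ Icc 0 t₁, ∀ x, L < ‖x‖ → m ≤ S t x) (h0 : ∀ x, m ≤ S 0 x) (x : Sp n) :
    m ≤ S t₁ x := by
  by_contra! hlt
  have ht0 : 0 < t₁ := by
    rcases ht₁.1.eq_or_lt with h1 | h1
    · rw [← h1] at hlt; exact absurd (h0 x) (not_le.2 hlt)
    · exact h1
  set ε := (m - S t₁ x) / (2 * t₁) with hε
  have hε0 : 0 < ε := div_pos (by linarith) (by linarith)
  have hεt : S t₁ x + ε * t₁ < m := by
    have : ε * t₁ = (m - S t₁ x) / 2 := by rw [hε]; field_simp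
    linarith
  have hsub : Icc 0 t₁ ⊆ Ico 0 T := fun t ht => ⟨ht.1, ht.2.trans_lt ht₁.2⟩
  set K := Icc 0 t₁ ×ˢ closedBall (0 : Sp n) (max L ‖x‖ + 1) with hK
  have hKc : IsCompact K := isCompact_Icc.prod (isCompact_closedBall _ _)
  have hxK : (t₁, x) ∈ K := by
    refine ⟨right_mem_Icc.2 ht₁.1, ?_⟩
    rw [mem_closedBall_zero_iff]
    linarith [le_max_right L ‖x‖]
  have hcont : ContinuousOn (fun q : ℝ × Sp n => S q.1 q.2 + ε * q.1) K :=
    (h.smooth_entropy.continuousOn.mono (prod_mono hsub (subset_univ _))).add (by fun_prop)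
  obtain ⟨⟨τ, ξ⟩, hq, hmin⟩ := hKc.exists_isMinOn ⟨_, hxK⟩ hcont
  have hmin' : ∀ s ∈ Icc 0 t₁, ∀ y, ‖y‖ ≤ max L ‖x‖ + 1 → S τ ξ + ε * τ ≤ S s y + ε * s :=
    fun s hs y hy => hmin (a := (s, y)) ⟨hs, mem_closedBall_zero_iff.2 hy⟩
  have hτ : τ ∈ Icc 0 t₁ := hq.1
  have hξ : ‖ξ‖ ≤ max L ‖x‖ + 1 := mem_closedBall_zero_iff.1 hq.2
  have hval : S τ ξ < m := by
    have := hmin' t₁ (right_mem_Icc.2 ht₁.1) x (by linarith [le_max_right L ‖x‖])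
    have h2 : 0 ≤ ε * τ := mul_nonneg hε0.le hτ.1
    linarith
  have hτ0 : 0 < τ := by
    rcases hτ.1.eq_or_lt with h1 | h1
    · rw [← h1] at hval; exact absurd (h0 ξ) (not_le.2 hval)
    · exact h1
  have hξL : ‖ξ‖ ≤ L := by
    by_contra! hc
    exact absurd (hfar τ hτ ξ hc) (not_le.2 hval)
  have hτT : τ ∈ Ioo 0 T := ⟨hτ0, hτ.2.trans_lt ht₁.2⟩
  have hloc : IsLocalMin (S τ) ξ := by
    have hb : ball (0 : Sp n) (max L ‖x‖ + 1) ∈ 𝓝 ξ := isOpen_ball.mem_nhds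
      (mem_ball_zero_iff.2 (by linarith [le_max_left L ‖x‖]))
    filter_upwards [hb] with y hy
    have := hmin' τ hτ y (mem_ball_zero_iff.1 hy).le
    linarith
  have ht := h.entropy_transport hτT ξ
  rw [hloc.fderiv_eq_zero] at ht
  have hdt : HasDerivAt (fun s => S s ξ + ε * s) ε τ := by
    have h1 := hasDerivAt_time h.smooth_entropy hτT ξ
    have h2 : HasDerivAt (fun s => S s ξ + ε * s) (deriv (fun s => S s ξ) τ + ε * 1) τ :=
      h1.add ((hasDerivAt_id τ).const_mul ε)
    simp only [zero_apply, add_zero] at ht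
    rwa [ht, zero_add, mul_one] at h2
  have hslope := (hasDerivAt_iff_tendsto_slope.1 hdt).mono_left
    (nhdsWithin_mono τ (fun s (hs : s ∈ Iio τ) => (ne_of_lt hs : s ≠ τ)))
  refine absurd (le_of_tendsto hslope ?_) (not_le.2 hε0)
  filter_upwards [Ioo_mem_nhdsLT hτ0] with s hs
  rw [slope_def_field]
  refine div_nonpos_of_nonneg_of_nonpos ?_ (by linarith [hs.2])
  have := hmin' s ⟨hs.1.le, hs.2.le.trans hτ.2⟩ ξ hξ
  linarith

end IsClassicalSolution

theorem exists_lipschitzWith_mul {X : Type*} [PseudoMetricSpace X] {f g : X → ℝ}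
    {Cf Cg : NNReal} {Mf Mg : ℝ} (hf : LipschitzWith Cf f) (hg : LipschitzWith Cg g)
    (bf : ∀ x, |f x| ≤ Mf) (bg : ∀ x, |g x| ≤ Mg) :
    ∃ C, LipschitzWith C (fun x => f x * g x) := by
  refine ⟨Real.toNNReal (Mf * Cg + Mg * Cf), LipschitzWith.of_dist_le_mul fun x y => ?_⟩
  have hMf : 0 ≤ Mf := (abs_nonneg _).trans (bf x)
  have hMg : 0 ≤ Mg := (abs_nonneg _).trans (bg x)
  rw [Real.coe_toNNReal _ (by positivity), Real.dist_eq]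
  have h1 := hf.dist_le_mul x y
  have h2 := hg.dist_le_mul x y
  rw [Real.dist_eq] at h1 h2
  calc |f x * g x - f y * g y| = |f x * (g x - g y) + g y * (f x - f y)| := by ring_nf
    _ ≤ |f x| * |g x - g y| + |g y| * |f x - f y| := by
        rw [← abs_mul, ← abs_mul]; exact abs_add_le _ _
    _ ≤ Mf * (Cg * dist x y) + Mg * (Cf * dist x y) := by
        gcongr
        · exact bf x
        · exact bg y
    _ = (Mf * Cg + Mg * Cf) * dist x y := by ring

section profile

variable {n : ℕ} {R k : ℝ}

/-- The radial factor `φ'(r) / r` of the gradient of `φ(|x|)`. -/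
noncomputable def gradFactor (R k r : ℝ) : ℝ :=
  2 * Cc R k * (1 - R * (max (R - R / k) (min r R))⁻¹)

/-- The gradient of `φ(|x|)`. -/
noncomputable def gradPhi (R k : ℝ) (x : Sp n) : Sp n := gradFactor R k ‖x‖ • x

open Classical in
/-- The Hessian of `φ(|x|)`, away from the spheres where it jumps. -/
noncomputable def hessPhi (R k : ℝ) (x : Sp n) : Sp n →L[ℝ] Sp n :=
  if ‖x‖ < R - R / k then (-(2 * Bc R k)) • ContinuousLinearMap.id ℝ (Sp n)
  else if ‖x‖ < R then
    (2 * Cc R k * (1 - R * ‖x‖⁻¹)) • ContinuousLinearMap.id ℝ (Sp n)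
      + (2 * Cc R k * (R * ‖x‖⁻¹ ^ 3)) • (innerSL ℝ x).smulRight x
  else 0

theorem Bc_pos (hR : 0 < R) (hk : 1 < k) : 0 < Bc R k :=
  div_pos (by linarith) (mul_pos (by positivity) (by linarith))

theorem Cc_eq (hR : 0 < R) (hk : 1 < k) : Cc R k = k / R ^ 2 := by
  have : k - 1 ≠ 0 := by linarith
  rw [Cc, Bc]; field_simp

theorem Cc_pos (hR : 0 < R) (hk : 1 < k) : 0 < Cc R k :=
  mul_pos (Bc_pos hR hk) (by linarith)

theorem inner_radius_pos (hR : 0 < R) (hk : 1 < k) : 0 < R - R / k := by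
  rw [sub_pos]; exact div_lt_self hR hk

theorem inner_radius_lt (hR : 0 < R) (hk : 1 < k) : R - R / k < R := by
  have : 0 < R / k := div_pos hR (by linarith)
  linarith

theorem Bc_mul_sq (hR : 0 < R) (hk : 1 < k) : Bc R k * (R - R / k) ^ 2 = 1 - 1 / k := by
  have h1 : k - 1 ≠ 0 := by linarith
  have h2 : k ≠ 0 := by linarith
  rw [Bc]; field_simp

theorem Cc_mul_sq (hR : 0 < R) (hk : 1 < k) : Cc R k * (R - R / k - R) ^ 2 = 1 / k := by
  have h2 : k ≠ 0 := by linarith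
  rw [Cc_eq hR hk]; field_simp; ring

theorem gradFactor_inner (hR : 0 < R) (hk : 1 < k) {r : ℝ} (hr : r ≤ R - R / k) :
    gradFactor R k r = -(2 * Bc R k) := by
  have h1 : k - 1 ≠ 0 := by linarith
  have h2 : k ≠ 0 := by linarith
  have ha := inner_radius_pos hR hk
  have haR := inner_radius_lt hR hk
  have e : R - R / k = R * (k - 1) / k := by field_simp
  rw [gradFactor, min_eq_left (by linarith), max_eq_left hr, Cc, e]
  field_simp
  ring

theorem gradFactor_middle {r : ℝ} (hr : R - R / k ≤ r) (hr' : r ≤ R) :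
    gradFactor R k r = 2 * Cc R k * (1 - R * r⁻¹) := by
  rw [gradFactor, min_eq_left hr', max_eq_right hr]

theorem gradFactor_outer (hR : 0 < R) (hk : 1 < k) {r : ℝ} (hr : R ≤ r) :
    gradFactor R k r = 0 := by
  rw [gradFactor, min_eq_right hr, max_eq_right (inner_radius_lt hR hk).le,
    mul_inv_cancel₀ hR.ne', sub_self, mul_zero]

theorem phi_eq (hR : 0 < R) (hk : 1 < k) (r : ℝ) :
    phi R k r = 1 - 1 / k - Bc R k * (min r (R - R / k) * min r (R - R / k))
      + Cc R k * ((max (R - R / k) (min r R) - R) * (max (R - R / k) (min r R) - R)) := by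
  have h1 := Bc_mul_sq hR hk
  have h2 := Cc_mul_sq hR hk
  have haR := inner_radius_lt hR hk
  unfold phi
  split_ifs with c1 c2
  · rw [min_eq_left c1.le, min_eq_left (c1.le.trans haR.le), max_eq_left c1.le]
    linear_combination -h2
  · rw [min_eq_right (not_lt.1 c1), min_eq_left c2, max_eq_right (not_lt.1 c1)]
    linear_combination h1
  · rw [min_eq_right (not_lt.1 c1), min_eq_right (not_le.1 c2).le, max_eq_right haR.le]
    linear_combination h1

theorem phi_outer (hR : 0 < R) (hk : 1 < k) {r : ℝ} (hr : R ≤ r) : phi R k r = 0 := by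
  have haR := inner_radius_lt hR hk
  unfold phi
  rw [if_neg (by linarith)]
  split_ifs with c
  · rw [le_antisymm c hr]; ring
  · rfl

theorem phi_nonneg (hR : 0 < R) (hk : 1 < k) {r : ℝ} (hr : 0 ≤ r) : 0 ≤ phi R k r := by
  have h1 := Bc_mul_sq hR hk
  have hB := Bc_pos hR hk
  have hC := Cc_pos hR hk
  have hk' : 0 < 1 / k := by positivity
  unfold phi
  split_ifs with c1 c2
  · have : Bc R k * r ^ 2 ≤ Bc R k * (R - R / k) ^ 2 := by gcongr
    linarith
  · positivity
  · exact le_rfl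

theorem phi_le_one (hR : 0 < R) (hk : 1 < k) {r : ℝ} : phi R k r ≤ 1 := by
  have h2 := Cc_mul_sq hR hk
  have hB := Bc_pos hR hk
  have hC := Cc_pos hR hk
  have hk' : 1 / k ≤ 1 := by rw [div_le_one] <;> linarith
  unfold phi
  split_ifs with c1 c2
  · have : 0 ≤ Bc R k * r ^ 2 := by positivity
    linarith
  · have h3 : (r - R) ^ 2 ≤ (R - R / k - R) ^ 2 := by
      rw [not_lt] at c1
      calc (r - R) ^ 2 = (R - r) ^ 2 := by ring
        _ ≤ (R / k) ^ 2 := pow_le_pow_left₀ (by linarith) (by linarith) 2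
        _ = (R - R / k - R) ^ 2 := by ring
    have := mul_le_mul_of_nonneg_left h3 hC.le
    linarith
  · exact zero_le_one

theorem lipschitz_phi_norm (hR : 0 < R) (hk : 1 < k) :
    ∃ C, LipschitzWith C (fun x : Sp n => phi R k ‖x‖) := by
  have ha := inner_radius_pos hR hk
  have haR := inner_radius_lt hR hk
  have l1 : LipschitzWith 1 (fun x : Sp n => min ‖x‖ (R - R / k)) :=
    lipschitzWith_one_norm.min_const _
  have l2 : LipschitzWith 1 (fun x : Sp n => max (R - R / k) (min ‖x‖ R) - R) := by
    have := (lipschitzWith_one_norm (E := Sp n)).min_const R |>.const_max (R - R / k)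
    simpa using this.sub (LipschitzWith.const R)
  have b1 : ∀ x : Sp n, |min ‖x‖ (R - R / k)| ≤ R := fun x => by
    rw [abs_of_nonneg (le_min (norm_nonneg _) ha.le)]
    exact (min_le_right _ _).trans haR.le
  have b2 : ∀ x : Sp n, |max (R - R / k) (min ‖x‖ R) - R| ≤ R := fun x => by
    have h1 : R - R / k ≤ max (R - R / k) (min ‖x‖ R) := le_max_left _ _
    have h2 : max (R - R / k) (min ‖x‖ R) ≤ R := max_le haR.le (min_le_right _ _)
    rw [abs_le]; constructor <;> linarith
  obtain ⟨C1, h1⟩ := exists_lipschitzWith_mul l1 l1 b1 b1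
  obtain ⟨C2, h2⟩ := exists_lipschitzWith_mul l2 l2 b2 b2
  have h1' := (lipschitzWith_smul (Bc R k)).comp h1
  have h2' := (lipschitzWith_smul (Cc R k)).comp h2
  simp only [phi_eq hR hk]
  exact ⟨_, ((LipschitzWith.const (1 - 1 / k)).sub h1').add h2'⟩

end profile

section profile

variable {n : ℕ} {R k : ℝ}

theorem hasCompactSupport_phi_norm (hR : 0 < R) (hk : 1 < k) :
    HasCompactSupport (fun x : Sp n => phi R k ‖x‖) :=
  HasCompactSupport.intro (isCompact_closedBall 0 R) fun x hx =>
    phi_outer hR hk (by simpa using (not_le.1 (fun h => hx (mem_closedBall_zero_iff.2 h))).le)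

theorem gradPhi_outer (hR : 0 < R) (hk : 1 < k) {x : Sp n} (hx : R ≤ ‖x‖) :
    gradPhi R k x = 0 := by
  rw [gradPhi, gradFactor_outer hR hk hx, zero_smul]

theorem hasCompactSupport_gradPhi (hR : 0 < R) (hk : 1 < k) (i : Fin n) :
    HasCompactSupport (fun x : Sp n => gradPhi R k x i) :=
  HasCompactSupport.intro (isCompact_closedBall 0 R) fun x hx => by
    rw [gradPhi_outer hR hk (not_le.1 (fun h => hx (mem_closedBall_zero_iff.2 h))).le]
    rfl

theorem lipschitz_gradPhi (hR : 0 < R) (hk : 1 < k) (i : Fin n) :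
    ∃ C, LipschitzWith C (fun x : Sp n => gradPhi R k x i) := by
  have ha := inner_radius_pos hR hk
  have haR := inner_radius_lt hR hk
  set a := R - R / k with hadef
  have hm : LipschitzWith 1 (fun x : Sp n => max a (min ‖x‖ R)) :=
    (lipschitzWith_one_norm.min_const R).const_max a
  have hma : ∀ x : Sp n, a ≤ max a (min ‖x‖ R) := fun x => le_max_left _ _
  have hinv : LipschitzWith (Real.toNNReal (a⁻¹ ^ 2)) (fun x : Sp n => (max a (min ‖x‖ R))⁻¹) := by
    refine LipschitzWith.of_dist_le_mul fun x y => ?_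
    have hx := ha.trans_le (hma x)
    have hy := ha.trans_le (hma y)
    rw [Real.coe_toNNReal _ (by positivity), Real.dist_eq, inv_sub_inv hx.ne' hy.ne', abs_div,
      abs_of_pos (mul_pos hx hy), div_eq_mul_inv, mul_comm]
    have h1 := hm.dist_le_mul x y
    rw [Real.dist_eq, NNReal.coe_one, one_mul, abs_sub_comm] at h1
    refine mul_le_mul ?_ h1 (abs_nonneg _) (by positivity)
    rw [sq, mul_inv]
    gcongr
    · exact hma x
    · exact hma y
  have hf : LipschitzWith _ (fun x : Sp n => gradFactor R k ‖x‖) :=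
    (lipschitzWith_smul (2 * Cc R k)).comp
      ((LipschitzWith.const 1).sub ((lipschitzWith_smul R).comp hinv))
  have bf : ∀ x : Sp n, |gradFactor R k ‖x‖| ≤ 2 * Cc R k * (1 + R * a⁻¹) := by
    intro x
    have hC := Cc_pos hR hk
    have hx := ha.trans_le (hma x)
    rw [gradFactor, abs_mul, abs_of_pos (by positivity : 0 < 2 * Cc R k)]
    gcongr
    refine (abs_sub _ _).trans ?_
    rw [abs_one, abs_of_pos (by positivity)]
    gcongr
    exact hma x
  have hg : LipschitzWith _ (fun x : Sp n => max (-R) (min (x i) R)) :=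
    ((EuclideanSpace.proj (𝕜 := ℝ) i : Sp n →L[ℝ] ℝ).lipschitz.min_const R).const_max (-R)
  have bg : ∀ x : Sp n, |max (-R) (min (x i) R)| ≤ R := fun x =>
    abs_le.2 ⟨le_max_left _ _, max_le (by linarith) (min_le_right _ _)⟩
  obtain ⟨C, hC⟩ := exists_lipschitzWith_mul hf hg bf bg
  have e : (fun x : Sp n => gradPhi R k x i)
      = fun x : Sp n => gradFactor R k ‖x‖ * max (-R) (min (x i) R) := by
    ext x
    rcases le_total R ‖x‖ with hx | hx
    · simp [gradPhi, gradFactor_outer hR hk hx]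
    · have h1 : |x i| ≤ R := (PiLp.norm_apply_le x i).trans hx
      rw [min_eq_left (abs_le.1 h1).2, max_eq_right (abs_le.1 h1).1]
      simp [gradPhi]
  rw [e]
  exact ⟨C, hC⟩

theorem hasFDerivAt_norm_of_ne {x : Sp n} (hx : x ≠ 0) :
    HasFDerivAt (fun y : Sp n => ‖y‖) (‖x‖⁻¹ • innerSL ℝ x) x := by
  have h : HasFDerivAt (fun y : Sp n => Real.sqrt (‖y‖ ^ 2))
      ((1 / (2 * Real.sqrt (‖x‖ ^ 2))) • (2 • innerSL ℝ x)) x :=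
    (hasStrictFDerivAt_norm_sq x).hasFDerivAt.sqrt (by positivity)
  simp only [Real.sqrt_sq (norm_nonneg _)] at h
  refine h.congr_fderiv ?_
  ext v
  have : ‖x‖ ≠ 0 := norm_ne_zero_iff.2 hx
  simp
  field_simp

theorem hasFDerivAt_phi_norm (hR : 0 < R) (hk : 1 < k) {x : Sp n}
    (h1 : ‖x‖ ≠ R - R / k) (h2 : ‖x‖ ≠ R) :
    HasFDerivAt (fun y : Sp n => phi R k ‖y‖) (innerSL ℝ (gradPhi R k x)) x := by
  have ha := inner_radius_pos hR hk
  have hnc : Tendsto (fun y : Sp n => ‖y‖) (𝓝 x) (𝓝 ‖x‖) := continuous_norm.continuousAt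
  rcases lt_or_gt_of_ne h1 with c1 | c1
  · have hev : (fun y : Sp n => phi R k ‖y‖) =ᶠ[𝓝 x] fun y => 1 - Bc R k * ‖y‖ ^ 2 := by
      filter_upwards [hnc.eventually (gt_mem_nhds c1)] with y hy
      rw [phi, if_pos hy]
    have hd := ((hasStrictFDerivAt_norm_sq x).hasFDerivAt.const_mul (Bc R k)).const_sub 1
    refine (hd.congr_of_eventuallyEq hev).congr_fderiv ?_
    ext v
    simp [gradPhi, gradFactor_inner hR hk c1.le]
    ring
  · rcases lt_or_gt_of_ne h2 with c2 | c2
    · have hx0 : x ≠ 0 := by rw [← norm_pos_iff]; linarith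
      have hev : (fun y : Sp n => phi R k ‖y‖) =ᶠ[𝓝 x] fun y => Cc R k * (‖y‖ - R) ^ 2 := by
        filter_upwards [hnc.eventually (lt_mem_nhds c1), hnc.eventually (gt_mem_nhds c2)]
          with y hy hy'
        rw [phi, if_neg (not_lt.2 (le_of_lt hy)), if_pos (le_of_lt hy')]
      have hd := (((hasFDerivAt_norm_of_ne hx0).sub_const R).pow 2).const_mul (Cc R k)
      refine (hd.congr_of_eventuallyEq hev).congr_fderiv ?_
      ext v
      have : ‖x‖ ≠ 0 := norm_ne_zero_iff.2 hx0
      simp [gradPhi, gradFactor_middle c1.le c2.le]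
      field_simp
    · have hev : (fun y : Sp n => phi R k ‖y‖) =ᶠ[𝓝 x] fun _ => 0 := by
        filter_upwards [hnc.eventually (lt_mem_nhds c2)] with y hy
        exact phi_outer hR hk (le_of_lt hy)
      refine ((hasFDerivAt_const (0 : ℝ) x).congr_of_eventuallyEq hev).congr_fderiv ?_
      rw [gradPhi_outer hR hk c2.le, map_zero]

theorem deriv_phi_div (hR : 0 < R) (hk : 1 < k) {r : ℝ} (h0 : r ≠ 0)
    (h1 : r ≠ R - R / k) (h2 : r ≠ R) : deriv (phi R k) r / r = gradFactor R k r := by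
  have ha := inner_radius_pos hR hk
  rcases lt_or_gt_of_ne h1 with c1 | c1
  · have hev : phi R k =ᶠ[𝓝 r] fun y => 1 - Bc R k * y ^ 2 := by
      filter_upwards [gt_mem_nhds c1] with y hy
      rw [phi, if_pos hy]
    have hd := ((hasDerivAt_pow 2 r).const_mul (Bc R k)).const_sub 1
    rw [hev.deriv_eq, hd.deriv, gradFactor_inner hR hk c1.le]
    simp
    field_simp
  · rcases lt_or_gt_of_ne h2 with c2 | c2
    · have hev : phi R k =ᶠ[𝓝 r] fun y => Cc R k * (y - R) ^ 2 := by
        filter_upwards [lt_mem_nhds c1, gt_mem_nhds c2] with y hy hy'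
        rw [phi, if_neg (not_lt.2 (le_of_lt hy)), if_pos (le_of_lt hy')]
      have hd := (((hasDerivAt_id r).sub_const R).pow 2).const_mul (Cc R k)
      have hd' := hd.deriv
      simp only [Pi.pow_def, id] at hd'
      rw [hev.deriv_eq, hd', gradFactor_middle c1.le c2.le]
      simp
      field_simp
    · have hev : phi R k =ᶠ[𝓝 r] fun _ => 0 := by
        filter_upwards [lt_mem_nhds c2] with y hy
        exact phi_outer hR hk (le_of_lt hy)
      rw [hev.deriv_eq, deriv_const, gradFactor_outer hR hk c2.le, zero_div]

theorem hasFDerivAt_gradPhi (hR : 0 < R) (hk : 1 < k) {x : Sp n}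
    (h1 : ‖x‖ ≠ R - R / k) (h2 : ‖x‖ ≠ R) :
    HasFDerivAt (gradPhi R k) (hessPhi R k x) x := by
  have ha := inner_radius_pos hR hk
  have hnc : Tendsto (fun y : Sp n => ‖y‖) (𝓝 x) (𝓝 ‖x‖) := continuous_norm.continuousAt
  rcases lt_or_gt_of_ne h1 with c1 | c1
  · have hev : gradPhi R k =ᶠ[𝓝 x] fun y => (-(2 * Bc R k)) • y := by
      filter_upwards [hnc.eventually (gt_mem_nhds c1)] with y hy
      rw [gradPhi, gradFactor_inner hR hk (le_of_lt hy)]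
    rw [hessPhi, if_pos c1]
    exact ((hasFDerivAt_id x).const_smul (-(2 * Bc R k))).congr_of_eventuallyEq hev
  · rcases lt_or_gt_of_ne h2 with c2 | c2
    · have hx0 : x ≠ 0 := by rw [← norm_pos_iff]; linarith
      have hn : ‖x‖ ≠ 0 := norm_ne_zero_iff.2 hx0
      have hev : gradPhi R k =ᶠ[𝓝 x] fun y => (2 * Cc R k * (1 - R * ‖y‖⁻¹)) • y := by
        filter_upwards [hnc.eventually (lt_mem_nhds c1), hnc.eventually (gt_mem_nhds c2)]
          with y hy hy'
        rw [gradPhi, gradFactor_middle (le_of_lt hy) (le_of_lt hy')]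
      rw [hessPhi, if_neg (not_lt.2 c1.le), if_pos c2]
      have hinv : HasFDerivAt (fun y : Sp n => ‖y‖⁻¹)
          ((-(‖x‖ ^ 2)⁻¹) • (‖x‖⁻¹ • innerSL ℝ x)) x :=
        (hasDerivAt_inv hn).comp_hasFDerivAt x (hasFDerivAt_norm_of_ne hx0)
      have hd := (((hinv.const_mul R).const_sub 1).const_mul (2 * Cc R k)).smul (hasFDerivAt_id x)
      refine (hd.congr_of_eventuallyEq hev).congr_fderiv ?_
      ext v i
      simp
      field_simp
    · have hev : gradPhi R k =ᶠ[𝓝 x] fun _ => 0 := by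
        filter_upwards [hnc.eventually (lt_mem_nhds c2)] with y hy
        exact gradPhi_outer hR hk (le_of_lt hy)
      rw [hessPhi, if_neg (not_lt.2 c1.le), if_neg (not_lt.2 c2.le)]
      exact (hasFDerivAt_const 0 x).congr_of_eventuallyEq hev

theorem hessPhi_outer (hR : 0 < R) (hk : 1 < k) {x : Sp n} (hx : R ≤ ‖x‖) :
    hessPhi R k x = 0 := by
  have haR := inner_radius_lt hR hk
  rw [hessPhi, if_neg (not_lt.2 (haR.le.trans hx)), if_neg (not_lt.2 hx)]

theorem inner_hessPhi_ge (hR : 0 < R) (hk : 1 < k) (x v : Sp n) :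
    -(2 * Bc R k) * ‖v‖ ^ 2 ≤ inner ℝ v (hessPhi R k x v) := by
  have hB := Bc_pos hR hk
  have hC := Cc_pos hR hk
  have ha := inner_radius_pos hR hk
  unfold hessPhi
  split_ifs with c1 c2
  · simp [inner_smul_right]
  · rw [not_lt] at c1
    have hx : 0 < ‖x‖ := ha.trans_le c1
    have e := gradFactor_inner hR hk (le_refl (R - R / k))
    rw [gradFactor_middle le_rfl (inner_radius_lt hR hk).le] at e
    have hle : -(2 * Bc R k) ≤ 2 * Cc R k * (1 - R * ‖x‖⁻¹) := by
      rw [← e]; gcongr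
    have hle' := mul_le_mul_of_nonneg_right hle (sq_nonneg ‖v‖)
    have hsq : 0 ≤ 2 * Cc R k * (R * ‖x‖⁻¹ ^ 3) * (inner ℝ x v) ^ 2 := by positivity
    have e2 : inner ℝ v (((2 * Cc R k * (1 - R * ‖x‖⁻¹)) • ContinuousLinearMap.id ℝ (Sp n)
      + (2 * Cc R k * (R * ‖x‖⁻¹ ^ 3)) • (innerSL ℝ x).smulRight x) v)
        = 2 * Cc R k * (1 - R * ‖x‖⁻¹) * ‖v‖ ^ 2
          + 2 * Cc R k * (R * ‖x‖⁻¹ ^ 3) * (inner ℝ x v) ^ 2 := by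
      simp [inner_add_right, inner_smul_right, real_inner_comm]
      exact Or.inl (by ring)
    rw [e2]
    linarith
  · simp only [zero_apply, inner_zero_right]
    have : 0 ≤ 2 * Bc R k * ‖v‖ ^ 2 := by positivity
    linarith

theorem ae_norm_ne {n : ℕ} (hn : 0 < n) (r : ℝ) : ∀ᵐ x : Sp n, ‖x‖ ≠ r := by
  have : Nonempty (Fin n) := ⟨⟨0, hn⟩⟩
  have h : volume (sphere (0 : Sp n) r) = 0 := Measure.addHaar_sphere volume 0 r
  filter_upwards [measure_eq_zero_iff_ae_notMem.1 h] with x hx hxr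
  exact hx (mem_sphere_zero_iff_norm.2 hxr)

end profile

theorem nonneg_of_mul_le_deriv2 {y y₁ y₂ : ℝ → ℝ} {b κ : ℝ} (hb : 0 ≤ b) (hκ : 0 ≤ κ)
    (hc : ContinuousOn y (Icc 0 b)) (hc₁ : ContinuousOn y₁ (Icc 0 b))
    (hd : ∀ t ∈ Ioo 0 b, HasDerivAt y (y₁ t) t) (hd₁ : ∀ t ∈ Ioo 0 b, HasDerivAt y₁ (y₂ t) t)
    (hle : ∀ t ∈ Ioo 0 b, κ * y t ≤ y₂ t) (h0 : 0 ≤ y 0)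
    (h1 : Real.sqrt κ * y 0 ≤ y₁ 0) : 0 ≤ y b := by
  set l := Real.sqrt κ with hl
  have hl2 : l * l = κ := Real.mul_self_sqrt hκ
  have step : ∀ t ∈ Icc 0 b, l * y t - y₁ t ≤ 0 := by
    intro t ht
    have hsub : Ioo 0 t ⊆ Ioo 0 b := Ioo_subset_Ioo_right ht.2
    refine nonpos_of_deriv_le_mul (E := fun s => l * y s - y₁ s) (C := -l)
      (E' := fun s => l * y₁ s - y₂ s) ht.1
      (((continuousOn_const.mul hc).sub hc₁).mono (Icc_subset_Icc_right ht.2))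
      (fun s hs => ((hd s (hsub hs)).const_mul l).sub (hd₁ s (hsub hs))) ?_ (by linarith)
    intro s hs
    have := hle s (hsub hs)
    rw [← hl2] at this
    linarith
  have := nonpos_of_deriv_le_mul (E := fun s => -y s) (C := l) (E' := fun s => -y₁ s) hb hc.neg
    (fun s hs => (hd s hs).neg)
    (fun s hs => by linarith [step s (Ioo_subset_Icc_self hs)]) (by linarith)
  linarith

theorem rpow_tangent_le {γ b G : ℝ} (hγ : 1 < γ) (hb : 0 < b) (hG : 0 ≤ G) :
    b ^ γ + γ * b ^ (γ - 1) * (G - b) ≤ G ^ γ := by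
  have h := one_add_mul_self_le_rpow_one_add (s := G / b - 1)
    (by linarith [div_nonneg hG hb.le]) hγ.le
  rw [add_sub_cancel, Real.div_rpow hG hb.le] at h
  have hbγ : 0 < b ^ γ := Real.rpow_pos_of_pos hb γ
  have h2 := mul_le_mul_of_nonneg_left h hbγ.le
  rw [mul_div_cancel₀ _ hbγ.ne'] at h2
  refine le_trans (le_of_eq ?_) h2
  rw [Real.rpow_sub_one hb.ne']
  field_simp

section weight

variable {n : ℕ} {R k : ℝ}

theorem continuous_phi_norm (hR : 0 < R) (hk : 1 < k) :
    Continuous (fun x : Sp n => phi R k ‖x‖) :=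
  (lipschitz_phi_norm hR hk).choose_spec.continuous

theorem integrable_mul_phi (hR : 0 < R) (hk : 1 < k) {f : Sp n → ℝ} (hf : Continuous f) :
    Integrable (fun x => f x * phi R k ‖x‖) :=
  (hf.mul (continuous_phi_norm hR hk)).integrable_of_hasCompactSupport
    (hasCompactSupport_phi_norm hR hk).mul_left

theorem Kc_pos (hR : 0 < R) (hk : 1 < k) : 0 < Kc n R k := by
  refine (continuous_phi_norm hR hk).integral_pos_of_hasCompactSupport_nonneg_nonzero (x := 0)
    (hasCompactSupport_phi_norm hR hk) (fun x => phi_nonneg hR hk (norm_nonneg x)) ?_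
  rw [norm_zero, phi, if_pos (inner_radius_pos hR hk)]
  norm_num

theorem Gphi_le_sSup_mul (hR : 0 < R) (hk : 1 < k) {f : Sp n → ℝ} (hf : Continuous f) :
    Gphi R k f ≤ sSup (f '' closedBall 0 R) * Kc n R k := by
  have hbdd := ((isCompact_closedBall (0 : Sp n) R).image hf).bddAbove
  rw [Gphi, Kc, ← integral_const_mul]
  refine integral_mono (integrable_mul_phi hR hk hf)
    (integrable_mul_phi hR hk continuous_const) fun x => ?_
  rcases le_total R ‖x‖ with hx | hx
  · simp [phi_outer hR hk hx]
  · exact mul_le_mul_of_nonneg_right (le_csSup hbdd ⟨x, mem_closedBall_zero_iff.2 hx, rfl⟩)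
      (phi_nonneg hR hk (norm_nonneg x))

theorem sInf_mul_le_Gphi (hR : 0 < R) (hk : 1 < k) {f : Sp n → ℝ} (hf : Continuous f) :
    sInf (f '' closedBall 0 R) * Kc n R k ≤ Gphi R k f := by
  have hbdd := ((isCompact_closedBall (0 : Sp n) R).image hf).bddBelow
  rw [Gphi, Kc, ← integral_const_mul]
  refine integral_mono (integrable_mul_phi hR hk continuous_const)
    (integrable_mul_phi hR hk hf) fun x => ?_
  rcases le_total R ‖x‖ with hx | hx
  · simp [phi_outer hR hk hx]
  · exact mul_le_mul_of_nonneg_right (csInf_le hbdd ⟨x, mem_closedBall_zero_iff.2 hx, rfl⟩)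
      (phi_nonneg hR hk (norm_nonneg x))

theorem Gphi_eq_setIntegral (hR : 0 < R) (hk : 1 < k) (f : Sp n → ℝ) :
    Gphi R k f = ∫ x in closedBall 0 R, f x * phi R k ‖x‖ := by
  rw [Gphi, setIntegral_eq_integral_of_forall_compl_eq_zero]
  intro x hx
  rw [phi_outer hR hk (not_le.1 (fun h => hx (mem_closedBall_zero_iff.2 h))).le, mul_zero]

theorem Gphi_nonneg (hR : 0 < R) (hk : 1 < k) {f : Sp n → ℝ} (hf : ∀ x, 0 ≤ f x) :
    0 ≤ Gphi R k f :=
  integral_nonneg fun x => mul_nonneg (hf x) (phi_nonneg hR hk (norm_nonneg x))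

theorem Gphi_le_setIntegral (hR : 0 < R) (hk : 1 < k) {f : Sp n → ℝ} (hf : Continuous f)
    (hf0 : ∀ x, 0 ≤ f x) {L : ℝ} (hL : R ≤ L) :
    Gphi R k f ≤ ∫ x in closedBall 0 L, f x := by
  have hi := hf.continuousOn.integrableOn_compact (μ := volume) (isCompact_closedBall (0 : Sp n) L)
  rw [Gphi_eq_setIntegral hR hk]
  refine (integral_mono (integrable_mul_phi hR hk hf).integrableOn
    (hi.mono_set (closedBall_subset_closedBall hL)) fun x =>
      mul_le_of_le_one_right (hf0 x) (phi_le_one hR hk)).trans ?_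
  exact setIntegral_mono_set hi (Eventually.of_forall hf0)
    (closedBall_subset_closedBall hL).eventuallyLE

/-- Hölder's inequality for the weighted mass. -/
theorem Gphi_rpow_mul_le {γ : ℝ} (hγ : 1 < γ) (hR : 0 < R) (hk : 1 < k) {f : Sp n → ℝ}
    (hf : Continuous f) (hf0 : ∀ x, 0 ≤ f x) :
    (∫ x in closedBall (0 : Sp n) R, phi R k ‖x‖ ^ (γ / (γ - 1))) ^ (1 - γ) * Gphi R k f ^ γ
      ≤ ∫ x in closedBall 0 R, f x ^ γ := by
  have hγ1 : 0 < γ - 1 := by linarith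
  have hγ0 : 0 < γ := by linarith
  have hconj : γ.HolderConjugate (γ / (γ - 1)) :=
    Real.HolderConjugate.conjExponent hγ
  set I := ∫ x in closedBall (0 : Sp n) R, phi R k ‖x‖ ^ (γ / (γ - 1)) with hI
  have hI0 : 0 ≤ I := integral_nonneg fun x =>
    Real.rpow_nonneg (phi_nonneg hR hk (norm_nonneg x)) _
  have hJ0 : 0 ≤ ∫ x in closedBall 0 R, f x ^ γ :=
    integral_nonneg fun x => Real.rpow_nonneg (hf0 x) _
  have hcb := isCompact_closedBall (0 : Sp n) R
  have hmem : ∀ {g : Sp n → ℝ} (q : ENNReal), Continuous g →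
      MemLp g q (volume.restrict (closedBall (0 : Sp n) R)) := by
    intro g q hg
    have : IsFiniteMeasure (volume.restrict (closedBall (0 : Sp n) R)) :=
      ⟨by rw [Measure.restrict_apply_univ]; exact hcb.measure_lt_top⟩
    obtain ⟨M, hM⟩ := hcb.exists_bound_of_continuousOn hg.continuousOn
    exact MemLp.of_bound hg.aestronglyMeasurable M
      ((ae_restrict_iff' hcb.measurableSet).2 (Eventually.of_forall hM))
  have hol := integral_mul_le_Lp_mul_Lq_of_nonneg hconj
    (μ := volume.restrict (closedBall (0 : Sp n) R)) (f := f) (g := fun x => phi R k ‖x‖)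
    (Eventually.of_forall hf0) (Eventually.of_forall fun x => phi_nonneg hR hk (norm_nonneg x))
    (hmem _ hf) (hmem _ (continuous_phi_norm hR hk))
  rw [← Gphi_eq_setIntegral hR hk] at hol
  rcases hI0.eq_or_lt with hz | hpos
  · rw [← hz, Real.zero_rpow (by linarith), zero_mul]
    exact hJ0
  · have h1 := Real.rpow_le_rpow (Gphi_nonneg hR hk hf0) hol hγ0.le
    rw [← hI, Real.mul_rpow (Real.rpow_nonneg hJ0 _) (Real.rpow_nonneg hI0 _),
      ← Real.rpow_mul hJ0, ← Real.rpow_mul hI0, one_div_mul_cancel hγ0.ne', Real.rpow_one,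
      show 1 / (γ / (γ - 1)) * γ = γ - 1 by field_simp] at h1
    calc I ^ (1 - γ) * Gphi R k f ^ γ
        ≤ I ^ (1 - γ) * ((∫ x in closedBall 0 R, f x ^ γ) * I ^ (γ - 1)) := by gcongr
      _ = (∫ x in closedBall 0 R, f x ^ γ) * (I ^ (1 - γ) * I ^ (γ - 1)) := by ring
      _ = ∫ x in closedBall 0 R, f x ^ γ := by
          rw [← Real.rpow_add hpos, show 1 - γ + (γ - 1) = 0 by ring, Real.rpow_zero, mul_one]

end weight

section soundSpeed

variable {γ rb pb R0 : ℝ}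

theorem soundSpeed_pos (hγ : 1 < γ) (hrb : 0 < rb) (hpb : 0 < pb) : 0 < soundSpeed γ rb pb :=
  Real.sqrt_pos.2 (by positivity)

theorem soundSpeed_sq_mul (hγ : 1 < γ) (hrb : 0 < rb) (hpb : 0 < pb) :
    soundSpeed γ rb pb ^ 2 * rb = γ * pb := by
  rw [soundSpeed, Real.sq_sqrt (by positivity)]
  field_simp

theorem frontRadius_mono (hγ : 1 < γ) (hrb : 0 < rb) (hpb : 0 < pb) {s t : ℝ} (hst : s ≤ t) :
    frontRadius γ rb pb R0 s ≤ frontRadius γ rb pb R0 t := by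
  have := (soundSpeed_pos hγ hrb hpb).le
  unfold frontRadius
  gcongr

theorem frontRadius_zero : frontRadius γ rb pb R0 0 = R0 := by simp [frontRadius]

theorem le_frontRadius (hγ : 1 < γ) (hrb : 0 < rb) (hpb : 0 < pb) {t : ℝ} (ht : 0 ≤ t) :
    R0 ≤ frontRadius γ rb pb R0 t := by
  have := frontRadius_mono (R0 := R0) hγ hrb hpb ht
  rwa [frontRadius_zero] at this

end soundSpeed

theorem A1_nonneg {n : ℕ} {γ R0 R k : ℝ} (hR : 0 < R) (hk : 1 < k) (hkn : (n : ℝ) < k)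
    {ρ0 p0 : Sp n → ℝ} : 0 ≤ A1 γ R0 R k ρ0 p0 := by
  refine mul_nonneg (mul_nonneg (by linarith) (Real.exp_pos _).le) (Real.rpow_nonneg ?_ _)
  exact integral_nonneg fun x => Real.rpow_nonneg (phi_nonneg hR hk (norm_nonneg x)) _

namespace IsClassicalSolution

variable {n : ℕ} {γ T rb pb R0 R k : ℝ} {ρ : ℝ → Sp n → ℝ} {V : ℝ → Sp n → Sp n}
  {p S : ℝ → Sp n → ℝ}

theorem pressure_nonneg (h : IsClassicalSolution γ T ρ V p S)
    {t : ℝ} (ht : t ∈ Ico 0 T) (x : Sp n) : 0 ≤ p t x := by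
  rw [h.state t ht x]
  exact mul_nonneg (Real.exp_pos _).le (Real.rpow_nonneg (h.density_nonneg t ht x) _)

theorem energyDensity_nonneg (h : IsClassicalSolution γ T ρ V p S)
    (hγ : 1 < γ) {t : ℝ} (ht : t ∈ Ico 0 T) (x : Sp n) :
    0 ≤ energyDensity γ ρ V p t x := by
  have h1 := h.pressure_nonneg ht x
  have h2 := h.density_nonneg t ht x
  have h3 : 0 ≤ 1 / (γ - 1) := by rw [one_div_nonneg]; linarith
  unfold energyDensity
  positivity

theorem constant_outside (h : IsClassicalSolution γ T ρ V p S)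
    (hγ : 1 < γ) (hrb : 0 < rb) (hpb : 0 < pb)
    (hdata : IsPerturbationData rb pb R0 (ρ 0) (V 0) (p 0))
    {t₁ t : ℝ} (ht₁ : t₁ < T) (ht : t ∈ Icc 0 t₁) {x : Sp n}
    (hx : frontRadius γ rb pb R0 t₁ < ‖x‖) : ρ t x = rb ∧ V t x = 0 ∧ p t x = pb := by
  refine h.finite_speed hγ hrb hpb (soundSpeed_pos hγ hrb hpb) (soundSpeed_sq_mul hγ hrb hpb)
    (R0 := R0) ?_ ⟨ht.1, ht.2.trans_lt ht₁⟩ ((frontRadius_mono hγ hrb hpb ht.2).trans_lt hx)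
  intro y hy
  have hy' : y ∉ ball (0 : Sp n) R0 := by simpa using hy
  exact ⟨hdata.density_far y hy', hdata.velocity_far y hy', hdata.pressure_far y hy'⟩

theorem entropy_eq (h : IsClassicalSolution γ T ρ V p S)
    {t : ℝ} (ht : t ∈ Ico 0 T) {x : Sp n} (hx : 0 < ρ t x) :
    S t x = initialEntropy γ (ρ t) (p t) x := by
  rw [initialEntropy, h.state t ht x, mul_div_cancel_right₀ _ (Real.rpow_pos_of_pos hx γ).ne',
    Real.log_exp]

theorem sInf_initialEntropy_le (h : IsClassicalSolution γ T ρ V p S)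
    (hn : 0 < n) (hγ : 1 < γ) (hrb : 0 < rb) (hpb : 0 < pb)
    (hR0 : 0 < R0) (hdata : IsPerturbationData rb pb R0 (ρ 0) (V 0) (p 0))
    {t : ℝ} (ht : t ∈ Ico 0 T) (x : Sp n) :
    sInf (initialEntropy γ (ρ 0) (p 0) '' closedBall 0 R0) ≤ S t x := by
  have h0 : (0 : ℝ) ∈ Ico 0 T := ⟨le_rfl, ht.1.trans_lt ht.2⟩
  have hS0 : initialEntropy γ (ρ 0) (p 0) = S 0 :=
    funext fun y => (h.entropy_eq h0 (hdata.density_pos y)).symm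
  have hbdd : BddBelow (initialEntropy γ (ρ 0) (p 0) '' closedBall 0 R0) := by
    rw [hS0]
    exact ((isCompact_closedBall _ _).image
      (slice_contDiff h.smooth_entropy h0).continuous).bddBelow
  have hfarval : sInf (initialEntropy γ (ρ 0) (p 0) '' closedBall 0 R0)
      ≤ Real.log (pb / rb ^ γ) := by
    set y : Sp n := EuclideanSpace.single ⟨0, hn⟩ R0 with hy
    have hyn : ‖y‖ = R0 := by simp [hy, abs_of_pos hR0]
    have hy' : y ∉ ball (0 : Sp n) R0 := by simp [hyn]
    refine csInf_le hbdd ⟨y, by simp [hyn], ?_⟩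
    rw [initialEntropy, hdata.density_far y hy', hdata.pressure_far y hy']
  refine h.le_entropy (L := frontRadius γ rb pb R0 t) ht ?_ ?_ x
  · intro s hs y hy
    obtain ⟨e1, -, e3⟩ := h.constant_outside hγ hrb hpb hdata ht.2 hs hy
    rw [h.entropy_eq ⟨hs.1, hs.2.trans_lt ht.2⟩ (by rw [e1]; exact hrb), initialEntropy, e1, e3]
    exact hfarval
  · intro y
    rcases le_or_gt ‖y‖ R0 with hy | hy
    · refine csInf_le hbdd ⟨y, by simpa using hy, ?_⟩
      rw [hS0]
    · have hy' : y ∉ ball (0 : Sp n) R0 := by simpa using hy.le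
      rw [← hS0, initialEntropy, hdata.density_far y hy', hdata.pressure_far y hy']
      exact hfarval

theorem setIntegral_density (h : IsClassicalSolution γ T ρ V p S)
    (hγ : 1 < γ) (hrb : 0 < rb) (hpb : 0 < pb) (hR0 : 0 < R0)
    (hdata : IsPerturbationData rb pb R0 (ρ 0) (V 0) (p 0)) {t : ℝ} (ht : t ∈ Ico 0 T) :
    ∫ x in closedBall 0 (frontRadius γ rb pb R0 t), ρ t x
      = excessMass rb R0 (ρ 0) + rb * unitBallVolume n * frontRadius γ rb pb R0 t ^ n := by
  have hfar := fun s (hs : s ∈ Icc 0 t) (x : Sp n) (hx : frontRadius γ rb pb R0 t < ‖x‖) =>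
    h.constant_outside hγ hrb hpb hdata ht.2 hs hx
  rw [setIntegral_closedBall_eq (Db := rb) (slice_contDiff h.smooth_density ht).continuous
    (hR0.le.trans (le_frontRadius hγ hrb hpb ht.1))
    (fun x hx => (hfar t (right_mem_Icc.2 ht.1) x hx).1),
    integral_sub_const_eq_of_conservation h.smooth_density h.smooth_massFlux
    (fun s hs x => h.mass_conservation hs x) ht (fun s hs x hx => (hfar s hs x hx).1)
    (fun s hs x hx => by rw [(hfar s hs x hx).2.1, smul_zero]), excessMass,
    setIntegral_eq_integral_of_forall_compl_eq_zero]
  intro x hx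
  rw [hdata.density_far x hx, sub_self]

theorem setIntegral_energyDensity (h : IsClassicalSolution γ T ρ V p S)
    (hγ : 1 < γ) (hrb : 0 < rb) (hpb : 0 < pb) (hR0 : 0 < R0)
    (hdata : IsPerturbationData rb pb R0 (ρ 0) (V 0) (p 0)) {t : ℝ} (ht : t ∈ Ico 0 T) :
    ∫ x in closedBall 0 (frontRadius γ rb pb R0 t), energyDensity γ ρ V p t x
      = excessEnergy γ pb R0 (ρ 0) (V 0) (p 0)
        + pb / (γ - 1) * unitBallVolume n * frontRadius γ rb pb R0 t ^ n := by
  have hfar := fun s (hs : s ∈ Icc 0 t) (x : Sp n) (hx : frontRadius γ rb pb R0 t < ‖x‖) =>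
    h.constant_outside hγ hrb hpb hdata ht.2 hs hx
  have hDfar : ∀ s ∈ Icc 0 t, ∀ x : Sp n, frontRadius γ rb pb R0 t < ‖x‖ →
      energyDensity γ ρ V p s x = pb / (γ - 1) := by
    intro s hs x hx
    obtain ⟨-, e2, e3⟩ := hfar s hs x hx
    simp [energyDensity, e2, e3]
    ring
  rw [setIntegral_closedBall_eq (slice_contDiff h.smooth_energyDensity ht).continuous
    (hR0.le.trans (le_frontRadius hγ hrb hpb ht.1)) (hDfar t (right_mem_Icc.2 ht.1)),
    integral_sub_const_eq_of_conservation h.smooth_energyDensity h.smooth_energyFlux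
    (fun s hs x => h.energy_conservation hγ hs x) ht hDfar
    (fun s hs x hx => by rw [energyFlux, (hfar s hs x hx).2.1, smul_zero])]
  congr 1
  have hcpt : ∀ {f : Sp n → ℝ}, Continuous f → (∀ x ∉ ball (0 : Sp n) R0, f x = 0) →
      Integrable f := fun hf hz => hf.integrable_of_hasCompactSupport
    (HasCompactSupport.intro (isCompact_closedBall 0 R0) fun x hx =>
      hz x fun hx' => hx (ball_subset_closedBall hx'))
  have i1 : Integrable (fun x => ρ 0 x * ‖V 0 x‖ ^ 2) :=
    hcpt (hdata.smooth_density.continuous.mul (hdata.smooth_velocity.continuous.norm.pow 2))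
      fun x hx => by simp [hdata.velocity_far x hx]
  have z2 : ∀ x ∉ ball (0 : Sp n) R0, p 0 x - pb = 0 := fun x hx => by
    rw [hdata.pressure_far x hx, sub_self]
  have i2 : Integrable (fun x => p 0 x - pb) :=
    hcpt (hdata.smooth_pressure.continuous.sub continuous_const) z2
  rw [excessEnergy, setIntegral_eq_integral_of_forall_compl_eq_zero z2, ← integral_const_mul,
    ← integral_const_mul, ← integral_add (i1.const_mul _) (i2.const_mul _)]
  refine integral_congr_ae (Eventually.of_forall fun x => ?_)
  simp only [energyDensity]
  ring

theorem Gphi_le_mass (h : IsClassicalSolution γ T ρ V p S)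
    (hγ : 1 < γ) (hrb : 0 < rb) (hpb : 0 < pb) (hR : 0 < R) (hRR0 : R ≤ R0)
    (hk : 1 < k) (hdata : IsPerturbationData rb pb R0 (ρ 0) (V 0) (p 0)) {t : ℝ}
    (ht : t ∈ Ico 0 T) :
    Gphi R k (ρ t) ≤ rb * Kc n R k + Qplus γ rb pb R0 R k (ρ 0) t := by
  refine (Gphi_le_setIntegral hR hk (slice_contDiff h.smooth_density ht).continuous
    (h.density_nonneg t ht) (hRR0.trans (le_frontRadius hγ hrb hpb ht.1))).trans ?_
  rw [h.setIntegral_density hγ hrb hpb (hR.trans_le hRR0) hdata ht, Qplus]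
  linarith

theorem continuousOn_Gphi (h : IsClassicalSolution γ T ρ V p S) (hR : 0 < R) (hk : 1 < k) :
    ContinuousOn (fun t => Gphi R k (ρ t)) (Ico 0 T) :=
  continuousOn_integral_mul h.smooth_density.continuousOn (continuous_phi_norm hR hk)
    (hasCompactSupport_phi_norm hR hk)

theorem continuousOn_momentumIntegral (h : IsClassicalSolution γ T ρ V p S)
    (hR : 0 < R) (hk : 1 < k) :
    ContinuousOn (fun t => ∑ i, ∫ x, (ρ t x * V t x i) * gradPhi R k x i) (Ico 0 T) := by
  refine continuousOn_finsetSum _ fun i _ => ?_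
  exact continuousOn_integral_mul (D := fun t x => ρ t x * V t x i)
    (h.smooth_density.mul (h.smooth_coord i)).continuousOn
    (lipschitz_gradPhi hR hk i).choose_spec.continuous (hasCompactSupport_gradPhi hR hk i)

theorem integrable_mul_gradPhi (hR : 0 < R) (hk : 1 < k) {f : Sp n → ℝ} (hf : Continuous f)
    (i : Fin n) : Integrable (fun x => f x * gradPhi R k x i) :=
  (hf.mul (lipschitz_gradPhi hR hk i).choose_spec.continuous).integrable_of_hasCompactSupport
    (hasCompactSupport_gradPhi hR hk i).mul_left

theorem momentumIntegral_eq (h : IsClassicalSolution γ T ρ V p S)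
    (hR : 0 < R) (hk : 1 < k) {t : ℝ} (ht : t ∈ Ico 0 T) :
    ∑ i, ∫ x, (ρ t x * V t x i) * gradPhi R k x i
      = ∫ x, inner ℝ (gradPhi R k x) (ρ t x • V t x) := by
  rw [← integral_finsetSum]
  · refine integral_congr_ae (Eventually.of_forall fun x => ?_)
    simp [PiLp.inner_apply]
  · intro i _
    exact integrable_mul_gradPhi hR hk (slice_contDiff (F := fun t x => ρ t x * V t x i)
      (h.smooth_density.mul (h.smooth_coord i)) ht).continuous i

theorem momentumIntegral_zero (h : IsClassicalSolution γ T ρ V p S)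
    (hn : 0 < n) (hR : 0 < R) (hk : 1 < k) (hT : 0 < T) :
    ∑ i, ∫ x, (ρ 0 x * V 0 x i) * gradPhi R k x i = Gphi' R k (ρ 0) (V 0) := by
  rw [h.momentumIntegral_eq hR hk ⟨le_rfl, hT⟩, Gphi']
  refine integral_congr_ae ?_
  filter_upwards [ae_norm_ne hn 0, ae_norm_ne hn (R - R / k), ae_norm_ne hn R] with x h0 h1 h2
  rw [deriv_phi_div hR hk h0 h1 h2, gradPhi, inner_smul_left, inner_smul_right,
    real_inner_comm]
  simp
  ring

theorem hasDerivAt_Gphi (h : IsClassicalSolution γ T ρ V p S)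
    (hn : 0 < n) (hR : 0 < R) (hk : 1 < k) {t : ℝ} (ht : t ∈ Ioo 0 T) :
    HasDerivAt (fun t => Gphi R k (ρ t))
      (∑ i, ∫ x, (ρ t x * V t x i) * gradPhi R k x i) t := by
  rw [h.momentumIntegral_eq hR hk (Ioo_subset_Ico_self ht)]
  obtain ⟨C, hC⟩ := lipschitz_phi_norm (n := n) hR hk
  refine hasDerivAt_integral_of_conservation (F := fun t x => ρ t x • V t x) h.smooth_density
    h.smooth_massFlux (fun s hs x => h.mass_conservation hs x) hC
    (hasCompactSupport_phi_norm hR hk) (w' := fun x => innerSL ℝ (gradPhi R k x)) ?_ ht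
  filter_upwards [ae_norm_ne hn (R - R / k), ae_norm_ne hn R] with x h1 h2
  exact hasFDerivAt_phi_norm hR hk h1 h2

theorem ae_hasFDerivAt_gradPhi_coord (hn : 0 < n) (hR : 0 < R) (hk : 1 < k) (i : Fin n) :
    ∀ᵐ x : Sp n, HasFDerivAt (fun x : Sp n => gradPhi R k x i)
      ((EuclideanSpace.proj (𝕜 := ℝ) i).comp (hessPhi R k x)) x := by
  filter_upwards [ae_norm_ne hn (R - R / k), ae_norm_ne hn R] with x h1 h2
  exact (EuclideanSpace.proj (𝕜 := ℝ) i).hasFDerivAt.comp x (hasFDerivAt_gradPhi hR hk h1 h2)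

theorem hasDerivAt_momentumIntegral (h : IsClassicalSolution γ T ρ V p S)
    (hn : 0 < n) (hR : 0 < R) (hk : 1 < k) {t : ℝ}
    (ht : t ∈ Ioo 0 T) :
    HasDerivAt (fun t => ∑ i, ∫ x, (ρ t x * V t x i) * gradPhi R k x i)
      (∑ i, ∫ x, (hessPhi R k x (momentumFlux ρ V p i t x)) i) t := by
  refine HasDerivAt.fun_sum fun i _ => ?_
  obtain ⟨C, hC⟩ := lipschitz_gradPhi (n := n) hR hk i
  exact hasDerivAt_integral_of_conservation (D := fun t x => ρ t x * V t x i)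
    (F := momentumFlux ρ V p i) (h.smooth_density.mul (h.smooth_coord i))
    (h.smooth_momentumFlux i) (fun s hs x => h.momentum_conservation hs x i) hC
    (hasCompactSupport_gradPhi hR hk i) (ae_hasFDerivAt_gradPhi_coord hn hR hk i) ht

theorem sum_hessPhi_momentumFlux (t : ℝ) (x : Sp n) :
    ∑ i, (hessPhi R k x (momentumFlux ρ V p i t x)) i
      = ρ t x * inner ℝ (V t x) (hessPhi R k x (V t x))
        + p t x * ∑ i, inner ℝ (EuclideanSpace.single i (1 : ℝ))
          (hessPhi R k x (EuclideanSpace.single i 1)) := by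
  have hs : ∀ (i : Fin n) (v : Sp n), inner ℝ (EuclideanSpace.single i (1 : ℝ)) v = v i :=
    fun i v => by rw [EuclideanSpace.inner_single_left, map_one, one_mul]
  simp only [hs, momentumFlux, map_add, map_smul, PiLp.add_apply, PiLp.smul_apply, smul_eq_mul,
    Finset.sum_add_distrib, Finset.mul_sum, PiLp.inner_apply, RCLike.inner_apply, conj_trivial]
  congr 1
  refine Finset.sum_congr rfl fun i _ => ?_
  ring

theorem le_sum_hessPhi_momentumFlux (h : IsClassicalSolution γ T ρ V p S)
    (hγ : 1 < γ) (hR : 0 < R) (hk : 1 < k) {t : ℝ}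
    (ht : t ∈ Ico 0 T) (x : Sp n) :
    2 * Bc R k * ((k - n) * p t x - A2 γ k * energyDensity γ ρ V p t x)
      ≤ ∑ i, (hessPhi R k x (momentumFlux ρ V p i t x)) i := by
  have hB := Bc_pos hR hk
  have hp := h.pressure_nonneg ht x
  have hρ := h.density_nonneg t ht x
  have hγ1 : 0 < γ - 1 := by linarith
  rw [sum_hessPhi_momentumFlux]
  have h1 := mul_le_mul_of_nonneg_left (inner_hessPhi_ge hR hk x (V t x)) hρ
  have h2 : ∑ _i : Fin n, (-(2 * Bc R k)) ≤ ∑ i, inner ℝ (EuclideanSpace.single i (1 : ℝ))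
      (hessPhi R k x (EuclideanSpace.single i 1)) := by
    refine Finset.sum_le_sum fun i _ => ?_
    have := inner_hessPhi_ge hR hk x (EuclideanSpace.single i (1 : ℝ))
    simpa using this
  have h3 := mul_le_mul_of_nonneg_left h2 hp
  simp only [Finset.sum_const, Finset.card_univ, Fintype.card_fin, nsmul_eq_mul] at h3
  have h4 : ρ t x * ‖V t x‖ ^ 2 + k * p t x ≤ A2 γ k * energyDensity γ ρ V p t x := by
    have a1 : 2 ≤ A2 γ k := le_max_left _ _
    have a2 : (γ - 1) * k ≤ A2 γ k := le_max_right _ _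
    have b1 := mul_le_mul_of_nonneg_right a1
      (by positivity : 0 ≤ 1 / 2 * (ρ t x * ‖V t x‖ ^ 2))
    have b2 := mul_le_mul_of_nonneg_right a2 (by positivity : 0 ≤ 1 / (γ - 1) * p t x)
    have b3 : (γ - 1) * k * (1 / (γ - 1) * p t x) = k * p t x := by field_simp
    rw [energyDensity, mul_add]
    linarith
  have h5 := mul_le_mul_of_nonneg_left h4 (by positivity : 0 ≤ 2 * Bc R k)
  linarith

/-- The second-order differential inequality for the weighted mass. -/
theorem le_sum_integral_hessPhi (h : IsClassicalSolution γ T ρ V p S)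
    (hn : 0 < n) (hγ : 1 < γ) (hrb : 0 < rb) (hpb : 0 < pb)
    (hR : 0 < R) (hRR0 : R ≤ R0) (hk : 1 < k) (hkn : (n : ℝ) < k)
    (hdata : IsPerturbationData rb pb R0 (ρ 0) (V 0) (p 0)) {t : ℝ} (ht : t ∈ Ioo 0 T) :
    kappaSq γ rb R0 R k (ρ 0) (p 0) * (Gphi R k (ρ t) - rb * Kc n R k)
        + Pn γ rb pb R0 R k (ρ 0) (V 0) (p 0) t
      ≤ ∑ i, ∫ x, (hessPhi R k x (momentumFlux ρ V p i t x)) i := by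
  have ht' := Ioo_subset_Ico_self ht
  have hB := Bc_pos hR hk
  have hR0 := hR.trans_le hRR0
  have hcb := isCompact_closedBall (0 : Sp n) R
  have hint : ∀ i : Fin n, Integrable (fun x => (hessPhi R k x (momentumFlux ρ V p i t x)) i) := by
    intro i
    obtain ⟨C, hC⟩ := lipschitz_gradPhi (n := n) hR hk i
    exact (integral_div_mul_eq_neg (slice_contDiff (h.smooth_momentumFlux i) ht') hC
      (hasCompactSupport_gradPhi hR hk i) (ae_hasFDerivAt_gradPhi_coord hn hR hk i)).1
  have hpc : Continuous (p t) := (slice_contDiff h.smooth_pressure ht').continuous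
  have hρc : Continuous (ρ t) := (slice_contDiff h.smooth_density ht').continuous
  have hec : Continuous (energyDensity γ ρ V p t) :=
    (slice_contDiff h.smooth_energyDensity ht').continuous
  have ip : IntegrableOn (p t) (closedBall 0 R) := hpc.continuousOn.integrableOn_compact hcb
  have ie : IntegrableOn (energyDensity γ ρ V p t) (closedBall 0 R) :=
    hec.continuousOn.integrableOn_compact hcb
  have s1 : 2 * Bc R k * ((k - n) * (∫ x in closedBall 0 R, p t x)
      - A2 γ k * ∫ x in closedBall 0 R, energyDensity γ ρ V p t x)
      ≤ ∑ i, ∫ x, (hessPhi R k x (momentumFlux ρ V p i t x)) i := by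
    rw [← integral_finsetSum _ fun i _ => hint i,
      ← setIntegral_eq_integral_of_forall_compl_eq_zero (s := closedBall 0 R)
        (f := fun x => ∑ i, (hessPhi R k x (momentumFlux ρ V p i t x)) i),
      ← integral_const_mul, ← integral_const_mul, ← integral_sub (ip.const_mul _) (ie.const_mul _),
      ← integral_const_mul]
    · exact integral_mono (((ip.const_mul _).sub (ie.const_mul _)).const_mul _)
        (integrable_finsetSum _ fun i _ => hint i).integrableOn
        (h.le_sum_hessPhi_momentumFlux hγ hR hk ht')
    · intro x hx
      rw [hessPhi_outer hR hk (not_le.1 (fun h => hx (mem_closedBall_zero_iff.2 h))).le]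
      simp
  have s2 : ∫ x in closedBall 0 R, energyDensity γ ρ V p t x
      ≤ excessEnergy γ pb R0 (ρ 0) (V 0) (p 0)
        + pb / (γ - 1) * unitBallVolume n * frontRadius γ rb pb R0 t ^ n := by
    rw [← h.setIntegral_energyDensity hγ hrb hpb hR0 hdata ht']
    exact setIntegral_mono_set (hec.continuousOn.integrableOn_compact (isCompact_closedBall _ _))
      (Eventually.of_forall (h.energyDensity_nonneg hγ ht'))
      (closedBall_subset_closedBall
        (hRR0.trans (le_frontRadius hγ hrb hpb ht'.1))).eventuallyLE
  set m := sInf (initialEntropy γ (ρ 0) (p 0) '' closedBall 0 R0) with hm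
  have s3 : Real.exp m * ∫ x in closedBall 0 R, ρ t x ^ γ ≤ ∫ x in closedBall 0 R, p t x := by
    rw [← integral_const_mul]
    refine integral_mono ((hρc.rpow_const
      fun x => Or.inr (by linarith)).continuousOn.integrableOn_compact hcb |>.const_mul _) ip
      fun x => ?_
    simp only [h.state t ht' x]
    refine mul_le_mul_of_nonneg_right (Real.exp_le_exp.2 ?_)
      (Real.rpow_nonneg (h.density_nonneg t ht' x) _)
    exact h.sInf_initialEntropy_le hn hγ hrb hpb hR0 hdata ht' x
  have s4 := Gphi_rpow_mul_le hγ hR hk hρc (h.density_nonneg t ht')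
  have s5 : A1 γ R0 R k (ρ 0) (p 0) * Gphi R k (ρ t) ^ γ
      ≤ (k - n) * ∫ x in closedBall 0 R, p t x := by
    rw [A1, mul_assoc, mul_assoc]
    refine mul_le_mul_of_nonneg_left ((mul_le_mul_of_nonneg_left s4 ?_).trans s3) (by linarith)
    exact (Real.exp_pos _).le
  have hA1 : 0 ≤ A1 γ R0 R k (ρ 0) (p 0) := A1_nonneg hR hk hkn
  have s6 := mul_le_mul_of_nonneg_left (rpow_tangent_le hγ
    (mul_pos hrb (Kc_pos (n := n) hR hk)) (Gphi_nonneg hR hk (h.density_nonneg t ht'))) hA1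
  have hA2 : 0 ≤ A2 γ k := zero_le_two.trans (le_max_left _ _)
  have s7 := mul_le_mul_of_nonneg_left s2 hA2
  refine le_trans ?_ s1
  rw [kappaSq, Pn]
  have s8 := mul_le_mul_of_nonneg_left (add_le_add (s6.trans s5) (neg_le_neg s7))
    (by positivity : 0 ≤ 2 * Bc R k)
  refine le_trans (le_of_eq ?_) (s8.trans (le_of_eq ?_)) <;> ring

theorem Qminus_le_Gphi (h : IsClassicalSolution γ T ρ V p S)
    (hn : 0 < n) (hγ : 1 < γ) (hrb : 0 < rb) (hpb : 0 < pb)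
    (hR : 0 < R) (hRR0 : R ≤ R0) (hk : 1 < k) (hkn : (n : ℝ) < k)
    (hdata : IsPerturbationData rb pb R0 (ρ 0) (V 0) (p 0)) {z : ℝ → ℝ}
    (hz : IsQminus γ rb pb R0 R k (ρ 0) (V 0) (p 0) z) {t : ℝ} (ht : t ∈ Ico 0 T) :
    rb * Kc n R k + z t ≤ Gphi R k (ρ t) := by
  obtain ⟨z', hz1, hz2, hz0, hz0'⟩ := hz
  have hsub : Icc 0 t ⊆ Ico 0 T := fun s hs => ⟨hs.1, hs.2.trans_lt ht.2⟩
  have hsub' : Ioo 0 t ⊆ Ioo 0 T := fun s hs => ⟨hs.1, hs.2.trans ht.2⟩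
  have hκ : 0 ≤ kappaSq γ rb R0 R k (ρ 0) (p 0) := by
    have hB := Bc_pos hR hk
    have hK := Kc_pos (n := n) hR hk
    have hA1 : 0 ≤ A1 γ R0 R k (ρ 0) (p 0) := A1_nonneg hR hk hkn
    unfold kappaSq
    positivity
  have hIci : Icc 0 t ⊆ Ici 0 := fun s hs => hs.1
  have key := nonneg_of_mul_le_deriv2 (b := t) (κ := kappaSq γ rb R0 R k (ρ 0) (p 0))
    (y := fun s => Gphi R k (ρ s) - rb * Kc n R k - z s)
    (y₁ := fun s => (∑ i, ∫ x, (ρ s x * V s x i) * gradPhi R k x i) - z' s)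
    (y₂ := fun s => (∑ i, ∫ x, (hessPhi R k x (momentumFlux ρ V p i s x)) i)
      - (kappaSq γ rb R0 R k (ρ 0) (p 0) * z s + Pn γ rb pb R0 R k (ρ 0) (V 0) (p 0) s))
    ht.1 hκ
    ((((h.continuousOn_Gphi hR hk).mono hsub).sub continuousOn_const).sub
      fun s hs => (hz1 s hs.1).continuousWithinAt.mono hIci)
    (((h.continuousOn_momentumIntegral hR hk).mono hsub).sub
      fun s hs => (hz2 s hs.1).continuousWithinAt.mono hIci)
    (fun s hs => ((h.hasDerivAt_Gphi hn hR hk (hsub' hs)).sub_const _).sub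
      ((hz1 s hs.1.le).hasDerivAt (Ici_mem_nhds hs.1)))
    (fun s hs => (h.hasDerivAt_momentumIntegral hn hR hk (hsub' hs)).sub
      ((hz2 s hs.1.le).hasDerivAt (Ici_mem_nhds hs.1)))
    (fun s hs => by
      have := h.le_sum_integral_hessPhi hn hγ hrb hpb hR hRR0 hk hkn hdata (hsub' hs)
      linarith)
    (by simp only [hz0]; linarith)
    (by
      rw [h.momentumIntegral_zero hn hR hk (ht.1.trans_lt ht.2), hz0, hz0']
      simp)
  linarith

theorem density_bounds (h : IsClassicalSolution γ T ρ V p S)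
    (hn : 0 < n) (hγ : 1 < γ) (hrb : 0 < rb) (hpb : 0 < pb)
    (hR : 0 < R) (hRR0 : R ≤ R0) (hk : (n : ℝ) < k)
    (hdata : IsPerturbationData rb pb R0 (ρ 0) (V 0) (p 0)) {z : ℝ → ℝ}
    (hz : IsQminus γ rb pb R0 R k (ρ 0) (V 0) (p 0) z) {t : ℝ} (ht : t ∈ Ico 0 T) :
    rb + z t / Kc n R k ≤ sSup (ρ t '' closedBall 0 R) ∧
      sInf (ρ t '' closedBall 0 R) ≤ rb + Qplus γ rb pb R0 R k (ρ 0) t / Kc n R k := by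
  have hk1 : 1 < k := lt_of_le_of_lt (by exact_mod_cast hn) hk
  have hK := Kc_pos (n := n) hR hk1
  have hc := (slice_contDiff h.smooth_density ht).continuous
  have e : ∀ q : ℝ, rb + q / Kc n R k = (rb * Kc n R k + q) / Kc n R k := fun q => by
    field_simp
  rw [e, e, div_le_iff₀ hK, le_div_iff₀ hK]
  exact ⟨(h.Qminus_le_Gphi hn hγ hrb hpb hR hRR0 hk1 hk hdata hz ht).trans
      (Gphi_le_sSup_mul hR hk1 hc),
    (sInf_mul_le_Gphi hR hk1 hc).trans (h.Gphi_le_mass hγ hrb hpb hR hRR0 hk1 hdata ht)⟩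

end IsClassicalSolution

section extrema

variable {X : Type*} [TopologicalSpace X] {f : ℝ → X → ℝ} {s : Set ℝ} {K : Set X}

theorem continuousOn_sSup_image (hK : IsCompact K)
    (hf : ContinuousOn (fun q : ℝ × X => f q.1 q.2) (s ×ˢ K)) :
    ContinuousOn (fun t => sSup (f t '' K)) s := by
  have : CompactSpace K := isCompact_iff_compactSpace.1 hK
  rw [continuousOn_iff_continuous_domRestrict]
  have hc : Continuous (fun q : s × K => f q.1 q.2) :=
    hf.comp_continuous (f := fun q : s × K => ((q.1 : ℝ), (q.2 : X))) (by fun_prop)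
      fun q => ⟨q.1.2, q.2.2⟩
  have := (isCompact_univ (X := K)).continuous_sSup (f := fun (t : s) (x : K) => f t x) hc
  refine this.congr fun t => ?_
  simp only [domRestrict_apply, image_univ]
  rw [image_eq_range]

theorem continuousOn_sInf_image (hK : IsCompact K)
    (hf : ContinuousOn (fun q : ℝ × X => f q.1 q.2) (s ×ˢ K)) :
    ContinuousOn (fun t => sInf (f t '' K)) s := by
  have : CompactSpace K := isCompact_iff_compactSpace.1 hK
  rw [continuousOn_iff_continuous_domRestrict]
  have hc : Continuous (fun q : s × K => f q.1 q.2) :=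
    hf.comp_continuous (f := fun q : s × K => ((q.1 : ℝ), (q.2 : X))) (by fun_prop)
      fun q => ⟨q.1.2, q.2.2⟩
  have := (isCompact_univ (X := K)).continuous_sInf (f := fun (t : s) (x : K) => f t x) hc
  refine this.congr fun t => ?_
  simp only [domRestrict_apply, image_univ]
  rw [image_eq_range]

theorem le_of_forall_Ico_le {f g : ℝ → ℝ} {b : ℝ} (hb : 0 < b) (hf : ContinuousOn f (Icc 0 b))
    (hg : ContinuousOn g (Icc 0 b)) (hfg : ∀ t ∈ Ico 0 b, f t ≤ g t) : f b ≤ g b := by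
  have hcl : closure (Ico 0 b) = Icc 0 b := closure_Ico hb.ne
  rw [← hcl] at hf hg
  exact le_on_closure hfg hf hg (by rw [hcl]; exact right_mem_Icc.2 hb.le)

end extrema

end EulerBounds

open EulerBounds in
theorem theorem4 {n : ℕ} (hn : 0 < n) (γ rbar pbar R0 R k : ℝ) (hγ : 1 < γ)
    (hrbar : 0 < rbar) (hpbar : 0 < pbar) (hR : 0 < R) (hRR0 : R ≤ R0) (hk : (n : ℝ) < k)
    (ρ0 : Sp n → ℝ) (V0 : Sp n → Sp n) (p0 : Sp n → ℝ)
    (hdata : IsPerturbationData rbar pbar R0 ρ0 V0 p0)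
    (Qminus : ℝ → ℝ) (hQminus : IsQminus γ rbar pbar R0 R k ρ0 V0 p0 Qminus) :
    (∀ (T : ℝ) (ρ : ℝ → Sp n → ℝ) (V : ℝ → Sp n → Sp n) (p S : ℝ → Sp n → ℝ),
      IsClassicalSolution γ T ρ V p S → ρ 0 = ρ0 → V 0 = V0 → p 0 = p0 →
      ∀ t ∈ Set.Ico 0 T,
        rbar + Qminus t / Kc n R k ≤ sSup (ρ t '' Metric.closedBall 0 R) ∧
        sInf (ρ t '' Metric.closedBall 0 R)
          ≤ rbar + Qplus γ rbar pbar R0 R k ρ0 t / Kc n R k) ∧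
    (∀ (tstar : ℝ) (ρ : ℝ → Sp n → ℝ) (V : ℝ → Sp n → Sp n) (p S : ℝ → Sp n → ℝ),
      0 < tstar → ρ 0 = ρ0 → V 0 = V0 → p 0 = p0 →
      ContinuousOn (fun q : ℝ × Sp n => ρ q.1 q.2)
        (Set.Icc 0 tstar ×ˢ Metric.closedBall 0 R) →
      (sSup (ρ tstar '' Metric.closedBall 0 R) < rbar + Qminus tstar / Kc n R k ∨
        rbar + Qplus γ rbar pbar R0 R k ρ0 tstar / Kc n R k
          < sInf (ρ tstar '' Metric.closedBall 0 R)) →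
      ¬ IsClassicalSolution γ tstar ρ V p S) := by
  refine ⟨?_, ?_⟩
  · rintro T ρ V p S h rfl rfl rfl t ht
    exact h.density_bounds hn hγ hrbar hpbar hR hRR0 hk hdata hQminus ht
  · rintro tstar ρ V p S htstar rfl rfl rfl hcont hviol h
    have hbounds := fun t ht =>
      h.density_bounds hn hγ hrbar hpbar hR hRR0 hk hdata hQminus (t := t) ht
    have hcb := isCompact_closedBall (0 : Sp n) R
    have hQ : ContinuousOn (fun t => rbar + Qminus t / Kc n R k) (Set.Icc 0 tstar) := by
      obtain ⟨z', hz, -⟩ := hQminus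
      refine continuousOn_const.add (ContinuousOn.div_const (fun t ht => ?_) _)
      exact (hz t ht.1).continuousWithinAt.mono fun s hs => hs.1
    have hQ' : Continuous
        (fun t => rbar + Qplus γ rbar pbar R0 R k (ρ 0) t / Kc n R k) := by
      unfold Qplus frontRadius
      fun_prop
    have h1 := le_of_forall_Ico_le htstar hQ (continuousOn_sSup_image hcb hcont)
      fun t ht => (hbounds t ht).1
    have h2 := le_of_forall_Ico_le htstar (continuousOn_sInf_image hcb hcont) hQ'.continuousOn
      fun t ht => (hbounds t ht).2
    rcases hviol with hv | hv
    · exact absurd h1 (not_le.2 hv)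
    · exact absurd h2 (not_le.2 hv)
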